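/- Let $F$ be a field of characteristic $2$. For $\alpha\in F$, $\beta\in F^\times$ let $[\alpha,\beta)$ be the quaternion algebra $F\langle i,j : i^2+i=\alpha,\ j^2=\beta,\ ij+ji=j\rangle$. Let $A$ be a biquaternion division algebra over $F$, i.e. a division algebra isomorphic to $[\alpha,\beta)\otimes_F[\gamma,\delta)$ for some $\alpha,\gamma\in F$ and $\beta,\delta\in F^\times$. A quadruple of (standard) generators of $A$ is a quadruple $(x,y,z,u)$ of elements generating $A$ as an $F$-algebra such that $x^2+x\in F$, $y^2\in F^\times$, $z^2+z\in F$, $u^2\in F^\times$, $xy+yx=y$, $zu+uz=u$, and each of $x,y$ commutes with each of $z,u$. The order of the two pairs $(x,y)$ and $(z,u)$ is disregarded, i.e. $(x,y,z,u)=(z,u,x,y)$. A step leads from a quadruple of generators $(x,y,z,u)$ to another one, and it is of type - $\Lambda_3$ if at most three generators are changed; - $\Lambda_2$ if at most one generator is changed in each pair; - $\Pi$ if at most one pair is changed; - $\Lambda_1$ if at most one generator is changed; - $\Omega_s$ if $x,z$ are preserved and $y,u$ are multiplied (on the left) by $a+b(x+z)$ for some $a,b\in F$; - $\Omega_i$ if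 $y,u$ are preserved and $a\,yu$ is added to both $x$ and $z$, for some $a\in F$; - $\Omega_c$ if $y,z$ are preserved, $x$ changes to $x+by(1+by)^{-1}z$ and $u$ changes to $(1+by)u$, for some $b\in F$. Then: 1. Any two quadruples of generators of $A$ are connected by a chain of at most three $\Lambda_3$-steps. 2. Each $\Lambda_3$-step can be achieved by a chain consisting of at most three $\Pi$-steps and at most two $\Lambda_2$-steps. 3. Each $\Pi$-step can be achieved by at most three $\Lambda_1$-steps. 4. Each $\Lambda_2$-step can be achieved by $\Lambda_1$-steps (at most seven) and at most one step of type $\Omega_i$, $\Omega_s$ or $\Omega_c$. More precisely: - a step $(x,y,z,u)\to(x',y,z',u)$ can be achieved by at most two $\Lambda_1$-steps and at most one $\Omega_i$-step; - a step $(x,y,z,u)\to(x,y',z,u')$ can be achieved by at most two $\Lambda_1$-steps and at most one $\Omega_s$-step; - a step $(x,y,z,u)\to(x',y,z,u')$ can be achieved by at most two $\Lambda_1$-steps and at most one $\Omega_c$-step if $xu'+u'x\neq u'$, and in every case by at most seven $\Lambda_1$-steps and at most one $\Omega_c$-step. 5. Any two quadruples of generators of $A$ are connected by a chain of at most $45$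 steps, of which at most $6$ are of type $\Omega_i$, $\Omega_s$ or $\Omega_c$ and all the others are of type $\Lambda_1$. -/

import Mathlib

open scoped TensorProduct

namespace BiquatChain

/-- The quaternion symbol algebra `[α, β)` over a field of characteristic two: generators `i`, `j`
with `i * i = α + i`, `j * j = β`, `i * j + j * i = j`. -/
abbrev Symbol (F : Type*) [Field F] (α β : F) : Type _ := QuaternionAlgebra F α 1 β

/-- `A` is a biquaternion algebra over `F` (of characteristic two): it is isomorphic to a tensor
product `[α, β) ⊗ [γ, δ)` with `β`, `δ` nonzero. -/
def IsBiquaternion (F A : Type*) [Field F] [Ring A] [Algebra F A] : Prop :=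
  ∃ α β γ δ : F, β ≠ 0 ∧ δ ≠ 0 ∧ Nonempty (A ≃ₐ[F] (Symbol F α β ⊗[F] Symbol F γ δ))

/-- A quadruple of standard generators `(x, y, z, u)` of `A` (in characteristic two). -/
@[ext]
structure Quad (F A : Type*) [Field F] [Ring A] [Algebra F A] where
  (x y z u : A)
  x_artinSchreier : ∃ α : F, x ^ 2 + x = algebraMap F A α
  y_squareCentral : ∃ β : F, β ≠ 0 ∧ y ^ 2 = algebraMap F A β
  z_artinSchreier : ∃ γ : F, z ^ 2 + z = algebraMap F A γ
  u_squareCentral : ∃ δ : F, δ ≠ 0 ∧ u ^ 2 = algebraMap F A δ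
  x_y : x * y + y * x = y
  z_u : z * u + u * z = u
  x_z : x * z = z * x
  x_u : x * u = u * x
  y_z : y * z = z * y
  y_u : y * u = u * y
  generate : Algebra.adjoin F {x, y, z, u} = ⊤

variable {F A : Type*} [Field F]

section Ring

variable [Ring A] [Algebra F A]

/-- The quadruple with the order of its two pairs `(x, y)`, `(z, u)` forgotten:
`(x, y, z, u)` and `(z, u, x, y)` are the same quadruple. -/
def Quad.cls (p : Quad F A) : Sym2 (A × A) := s((p.x, p.y), (p.z, p.u))

/-- At most three generators are changed. -/
def LambdaThree (p q : Quad F A) : Prop :=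
  q.x = p.x ∨ q.y = p.y ∨ q.z = p.z ∨ q.u = p.u

/-- At most one generator is changed in each pair. -/
def LambdaTwo (p q : Quad F A) : Prop :=
  (q.x = p.x ∨ q.y = p.y) ∧ (q.z = p.z ∨ q.u = p.u)

/-- At most one pair is changed. -/
def PairChange (p q : Quad F A) : Prop :=
  (q.x = p.x ∧ q.y = p.y) ∨ (q.z = p.z ∧ q.u = p.u)

/-- At most one generator is changed. -/
def LambdaOne (p q : Quad F A) : Prop :=
  (q.y = p.y ∧ q.z = p.z ∧ q.u = p.u) ∨ (q.x = p.x ∧ q.z = p.z ∧ q.u = p.u) ∨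
  (q.x = p.x ∧ q.y = p.y ∧ q.u = p.u) ∨ (q.x = p.x ∧ q.y = p.y ∧ q.z = p.z)

/-- `x`, `z` are preserved, and `y`, `u` are multiplied by `a + b (x + z)`. -/
def OmegaS (p q : Quad F A) : Prop :=
  ∃ a b : F, q.x = p.x ∧ q.z = p.z ∧
    q.y = (algebraMap F A a + b • (p.x + p.z)) * p.y ∧
    q.u = (algebraMap F A a + b • (p.x + p.z)) * p.u

/-- `y`, `u` are preserved, and `a y u` is added to `x` and to `z`. -/
def OmegaI (p q : Quad F A) : Prop :=
  ∃ a : F, q.y = p.y ∧ q.u = p.u ∧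
    q.x = p.x + a • (p.y * p.u) ∧ q.z = p.z + a • (p.y * p.u)

/-- A step between quadruples whose pairs are not ordered: an `R`-step for some ordering
of the two pairs of each. -/
def Step (R : Quad F A → Quad F A → Prop) (P Q : Sym2 (A × A)) : Prop :=
  ∃ p q : Quad F A, p.cls = P ∧ q.cls = Q ∧ R p q

end Ring

/-- `y`, `z` are preserved, `x` changes to `x + b y (1 + b y)⁻¹ z`, and `u` changes to
`(1 + b y) u`. -/
def OmegaC [DivisionRing A] [Algebra F A] (p q : Quad F A) : Prop :=
  ∃ b : F, q.y = p.y ∧ q.z = p.z ∧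
    q.x = p.x + (b • p.y) * (1 + b • p.y)⁻¹ * p.z ∧ q.u = (1 + b • p.y) * p.u

/-- A step of one of the three types `OmegaI`, `OmegaS`, `OmegaC`. -/
def Omega [DivisionRing A] [Algebra F A] (p q : Quad F A) : Prop :=
  OmegaI p q ∨ OmegaS p q ∨ OmegaC p q

/-- `Chain R S m n P Q`: one can go from `P` to `Q` by a finite chain of steps, at most `m` of
them `R`-steps and at most `n` of them `S`-steps (in any order), and no other steps. -/
inductive Chain {X : Type*} (R S : X → X → Prop) : ℕ → ℕ → X → X → Prop
  | refl (m n : ℕ) (P : X) : Chain R S m n P P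
  | left {m n : ℕ} {P Q T : X} : R P Q → Chain R S m n Q T → Chain R S (m + 1) n P T
  | right {m n : ℕ} {P Q T : X} : S P Q → Chain R S m n Q T → Chain R S m (n + 1) P T

/-- `ChainOf R m P Q`: one can go from `P` to `Q` by at most `m` steps, all of them `R`-steps. -/
def ChainOf {X : Type*} (R : X → X → Prop) (m : ℕ) (P Q : X) : Prop :=
  Chain R (fun _ _ => False) m 0 P Q

end BiquatChain

/-! Write [a,b] = ab + ba. In characteristic 2 this is the commutator, so [a,·] is a derivation and
[a,[a,b]] = [a²,b]. Hence [x,·] is idempotent for an Artin-Schreier x, and has square zero for a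
square-central x. Say that x flips v when [x,v] = v. Every [x,a] is flipped by x, and quotients of
flipped elements commute with x; most new generators arise in this way.

The other tool is a dimension count. Adjoining t to a set doubles the dimension at least, if some c
commutes with the set but not with t (`two_mul_finrank_adjoin_le`). As dim A = 16, whatever commutes
with four standard generators is scalar, the commutation relations alone make a quadruple
(`Rel.quad`), and a noncentral element with noncommutative centralizer is quadratic
(`exists_sq_eq_of_br_ne_zero`). A suitable quadratic element commuting with a standard pair then
completes it to a quadruple.

For two quadruples with first generators x, x′, put v = [x,x′]. If v = 0, then x and x′ lie in a
common quadruple or differ by a scalar. If v² is a nonzero scalar, v can be the partner of both.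
Otherwise v² is quadratic and commutes with x and x′; normalized, it serves as a third or fourth
generator beside each of them. This gives three Λ₃-steps. A Λ₃-step splits into Λ₂, Λ₂, Π by means
of one element v usable as fourth generator on both sides. In a Λ₂-step, the obstruction to changing
the generators one at a time is measured by a scalar or by a combination of 1 and x + z, and one
Ω-step removes it. -/

namespace BiquatChain

set_option linter.unusedSectionVars false

variable {F A : Type*} [Field F]

/-! ### Calculus of the commutator in characteristic two -/

section Bracket

variable [Ring A]

/-- The commutator in characteristic two. -/
def br (a b : A) : A := a * b + b * a

theorem br_def (a b : A) : br a b = a * b + b * a := rfl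

theorem br_comm (a b : A) : br a b = br b a := add_comm _ _

theorem br_add_right (a b c : A) : br a (b + c) = br a b + br a c := by
  simp only [br]; grind

theorem br_add_left (a b c : A) : br (a + b) c = br a c + br b c := by
  simp only [br]; grind

variable [CharP A 2]

theorem add_self_zero (a : A) : a + a = 0 := CharTwo.add_self_eq_zero a

theorem br_self (a : A) : br a a = 0 := add_self_zero _

theorem br_one_right (a : A) : br a 1 = 0 := by simp [br, add_self_zero]

theorem br_eq_zero {a b : A} : br a b = 0 ↔ a * b = b * a := CharTwo.add_eq_zero

theorem br_mul_right (a b c : A) : br a (b * c) = br a b * c + b * br a c := by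
  simp only [br]; grind

theorem br_mul_left (a b c : A) : br (a * b) c = a * br b c + br a c * b := by
  simp only [br]; grind

theorem br_br_self (a b : A) : br a (br a b) = br (a ^ 2) b := by
  simp only [br]; grind

theorem br_jacobi (a b c : A) : br a (br b c) = br (br a b) c + br b (br a c) := by
  simp only [br]; grind

theorem br_sq_of_flip {x y : A} (h : br x y = y) : br x (y ^ 2) = 0 := by
  rw [pow_two, br_mul_right, h, add_self_zero]

theorem br_mul_of_flip {x y z : A} (h : br x y = y) (h' : br x z = z) : br x (y * z) = 0 := by
  rw [br_mul_right, h, h', add_self_zero]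

variable [Algebra F A]

theorem br_algebraMap (a : A) (c : F) : br a (algebraMap F A c) = 0 :=
  br_eq_zero.mpr (Algebra.commutes c a).symm

theorem br_smul_right (a b : A) (c : F) : br a (c • b) = c • br a b := by
  simp [br, smul_add]

theorem br_smul_left (a b : A) (c : F) : br (c • a) b = c • br a b := by
  simp [br, smul_add]

/-- An Artin-Schreier element acts as an idempotent. -/
theorem br_br_of_artinSchreier {a : A} (h : ∃ c : F, a ^ 2 + a = algebraMap F A c) (b : A) :
    br a (br a b) = br a b := by
  obtain ⟨c, hc⟩ := h
  have h1 : a ^ 2 = algebraMap F A c + a := by rw [← hc]; grind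
  rw [br_br_self, h1, br_add_left, br_comm, br_algebraMap, zero_add]

/-- A square-central element acts with square zero. -/
theorem br_br_of_squareCentral {a : A} (h : ∃ c : F, a ^ 2 = algebraMap F A c) (b : A) :
    br a (br a b) = 0 := by
  obtain ⟨c, hc⟩ := h
  rw [br_br_self, hc, br_comm, br_algebraMap]

end Bracket

/-! ### Dimension counts and standard relations -/

section Division

variable [DivisionRing A] [CharP A 2]

theorem br_inv_of_br_eq_zero {x y : A} (h : br x y = 0) : br x y⁻¹ = 0 := by
  rw [br_eq_zero] at h ⊢
  exact (Commute.inv_right₀ h : Commute x y⁻¹)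

theorem br_inv_of_flip {x y : A} (h : br x y = y) (hy : y ≠ 0) : br x y⁻¹ = y⁻¹ := by
  have h1 : y⁻¹ * y = 1 := inv_mul_cancel₀ hy
  have h2 : y * y⁻¹ = 1 := mul_inv_cancel₀ hy
  have h3 : y⁻¹ * (br x y) * y⁻¹ = y⁻¹ := by rw [h, h1, one_mul]
  have h4 : y⁻¹ * (br x y) * y⁻¹ = y⁻¹ * x * (y * y⁻¹) + (y⁻¹ * y) * x * y⁻¹ := by
    simp only [br]; grind
  rw [h3, h1, h2] at h4
  rw [h4]; simp only [br]; grind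

theorem br_mul_inv_of_flip {x a b : A} (ha : br x a = a) (hb : br x b = b) :
    br x (a * b⁻¹) = 0 := by
  by_cases h : b = 0
  · simp [h, br]
  · exact br_mul_of_flip ha (br_inv_of_flip hb h)

variable [Algebra F A] [FiniteDimensional F A]

/-- Adjoining an element that fails to commute with some `c` commuting with the rest
at least doubles the dimension. -/
theorem two_mul_finrank_adjoin_le (s : Set A) (t c : A) (hs : ∀ a ∈ s, br c a = 0)
    (ht : br c t ≠ 0) :
    2 * Module.finrank F (Algebra.adjoin F s) ≤
      Module.finrank F (Algebra.adjoin F (insert t s)) := by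
  set S := Algebra.adjoin F s
  set T := Algebra.adjoin F (insert t s)
  have hST : S ≤ T := Algebra.adjoin_mono (Set.subset_insert t s)
  have htT : t ∈ T := Algebra.subset_adjoin (Set.mem_insert t s)
  have hS : ∀ a ∈ S, c * a = a * c := by
    have : S ≤ Subalgebra.centralizer F {c} := by
      refine Algebra.adjoin_le fun a ha => ?_
      rw [SetLike.mem_coe, Subalgebra.mem_centralizer_iff]
      rintro g rfl
      exact br_eq_zero.mp (hs a ha)
    intro a ha
    exact (Subalgebra.mem_centralizer_iff F).mp (this ha) c rfl
  let f : (S × S) →ₗ[F] T :=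
    { toFun := fun p => ⟨p.1 + p.2 * t, T.add_mem (hST p.1.2) (T.mul_mem (hST p.2.2) htT)⟩
      map_add' := fun p q => by ext; simp [add_mul]; abel
      map_smul' := fun r p => by ext; simp [smul_add] }
  have hf : Function.Injective f := by
    rw [injective_iff_map_eq_zero]
    rintro ⟨a, b⟩ hab
    have h1 : (a : A) + b * t = 0 := congrArg Subtype.val hab
    -- Otherwise t = b⁻¹a (signs are irrelevant) would commute with c.
    have hb : (b : A) = 0 := by
      by_contra hb
      apply ht
      have h2 : t = (b : A)⁻¹ * a := by
        rw [← CharTwo.add_eq_zero.mp h1.symm.symm |>.symm, inv_mul_cancel_left₀ hb]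
      rw [h2, br_mul_right, br_inv_of_br_eq_zero (br_eq_zero.mpr (hS b b.2)),
        br_eq_zero.mpr (hS a a.2)]
      simp
    have ha : (a : A) = 0 := by simpa [hb] using h1
    ext <;> simp [ha, hb]
  have := LinearMap.finrank_le_finrank_of_injective hf
  rw [Module.finrank_prod] at this
  omega

theorem two_le_finrank_adjoin_singleton {e : A} (he : ∀ c : F, e ≠ algebraMap F A c) :
    2 ≤ Module.finrank F (Algebra.adjoin F {e}) := by
  have h0 : 0 < Module.finrank F (Algebra.adjoin F {e}) := Module.finrank_pos
  have h1 : Module.finrank F (Algebra.adjoin F {e}) ≠ 1 := by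
    intro h
    have h2 := Subalgebra.eq_bot_of_finrank_one h
    have h3 : e ∈ (⊥ : Subalgebra F A) := h2 ▸ Algebra.subset_adjoin rfl
    obtain ⟨c, hc⟩ := Algebra.mem_bot.mp h3
    exact he c hc.symm
  omega

/-- The commutation relations between standard generators. -/
structure Rel (x y z u : A) : Prop where
  xy : br x y = y
  zu : br z u = u
  xz : br x z = 0
  xu : br x u = 0
  yz : br y z = 0
  yu : br y u = 0
  y_ne : y ≠ 0
  u_ne : u ≠ 0

theorem Quad.rel (p : Quad F A) : Rel p.x p.y p.z p.u where
  xy := p.x_y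
  zu := p.z_u
  xz := br_eq_zero.mpr p.x_z
  xu := br_eq_zero.mpr p.x_u
  yz := br_eq_zero.mpr p.y_z
  yu := br_eq_zero.mpr p.y_u
  y_ne := by
    obtain ⟨β, hβ, h⟩ := p.y_squareCentral
    rintro h0
    rw [h0] at h
    exact hβ ((algebraMap F A).injective (by rw [← h]; simp))
  u_ne := by
    obtain ⟨β, hβ, h⟩ := p.u_squareCentral
    rintro h0
    rw [h0] at h
    exact hβ ((algebraMap F A).injective (by rw [← h]; simp))

variable {x y z u : A}

omit [FiniteDimensional F A] [Algebra F A] in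
theorem Rel.swap (r : Rel x y z u) : Rel z u x y :=
  ⟨r.zu, r.xy, br_comm x z ▸ r.xz, br_comm y z ▸ r.yz, br_comm x u ▸ r.xu, br_comm y u ▸ r.yu,
    r.u_ne, r.y_ne⟩

/-- Four doublings, adjoining z, u, x, y in turn; the witness of noncommutation is each time the
partner in the pair. -/
theorem Rel.le_finrank (r : Rel x y z u) {s : Set A} (hx : ∀ a ∈ s, br x a = 0)
    (hy : ∀ a ∈ s, br y a = 0) (hz : ∀ a ∈ s, br z a = 0) (hu : ∀ a ∈ s, br u a = 0) :
    16 * Module.finrank F (Algebra.adjoin F s) ≤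
      Module.finrank F (Algebra.adjoin F (insert y (insert x (insert u (insert z s))))) := by
  have h1 := two_mul_finrank_adjoin_le (F := F) s z u hu (by rw [br_comm, r.zu]; exact r.u_ne)
  have h2 := two_mul_finrank_adjoin_le (F := F) (insert z s) u z
    (by rintro a (rfl | ha); exacts [br_self _, hz a ha]) (by rw [r.zu]; exact r.u_ne)
  have h3 := two_mul_finrank_adjoin_le (F := F) (insert u (insert z s)) x y
    (by rintro a (rfl | rfl | ha); exacts [r.yu, r.yz, hy a ha])
    (by rw [br_comm, r.xy]; exact r.y_ne)
  have h4 := two_mul_finrank_adjoin_le (F := F) (insert x (insert u (insert z s))) y x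
    (by rintro a (rfl | rfl | rfl | ha); exacts [br_self _, r.xu, r.xz, hx a ha])
    (by rw [r.xy]; exact r.y_ne)
  omega

variable (h16 : Module.finrank F A = 16)

theorem finrank_adjoin_le (s : Set A) : Module.finrank F (Algebra.adjoin F s) ≤ Module.finrank F A :=
  Submodule.finrank_le (Subalgebra.toSubmodule (Algebra.adjoin F s))

include h16 in
/-- What commutes with the generators is a scalar. -/
theorem Rel.exists_algebraMap (r : Rel x y z u) {e : A} (hx : br x e = 0) (hy : br y e = 0)
    (hz : br z e = 0) (hu : br u e = 0) : ∃ c : F, e = algebraMap F A c := by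
  by_contra! h
  have h1 := r.le_finrank (F := F) (s := {e}) (by simpa) (by simpa) (by simpa) (by simpa)
  have h2 := two_le_finrank_adjoin_singleton h
  have h3 := finrank_adjoin_le (F := F) (insert y (insert x (insert u (insert z {e}))))
  omega

include h16 in
theorem Rel.adjoin_eq_top (r : Rel x y z u) : Algebra.adjoin F {x, y, z, u} = ⊤ := by
  have h1 := r.le_finrank (F := F) (s := ∅) (by simp) (by simp) (by simp) (by simp)
  have h0 : 0 < Module.finrank F (Algebra.adjoin F (∅ : Set A)) := Module.finrank_pos
  have h3 : (insert y (insert x (insert u (insert z ∅))) : Set A) = {x, y, z, u} := by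
    ext a; simp; tauto
  rw [h3] at h1
  have h4 := finrank_adjoin_le (F := F) ({x, y, z, u} : Set A)
  apply Algebra.toSubmodule_eq_top.mp
  apply Submodule.eq_top_of_finrank_eq
  change Module.finrank F (Algebra.adjoin F {x, y, z, u}) = _
  omega

omit [FiniteDimensional F A] [Algebra F A] in
theorem br_artinSchreier_of_flip (h : br x y = y) : br y (x ^ 2 + x) = 0 := by
  rw [br_add_right, br_comm y, ← br_br_self, h, br_comm y, h, add_self_zero]

omit [FiniteDimensional F A] [Algebra F A] in
theorem br_sq_of_br_eq_zero (h : br x y = 0) : br x (y ^ 2) = 0 := by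
  rw [pow_two, br_mul_right, h]; simp

include h16 in
theorem Rel.x_artinSchreier (r : Rel x y z u) : ∃ α : F, x ^ 2 + x = algebraMap F A α := by
  have hz := br_comm x z ▸ r.xz
  have hu := br_comm x u ▸ r.xu
  refine r.exists_algebraMap h16 ?_ (br_artinSchreier_of_flip r.xy) ?_ ?_
  · rw [br_add_right, br_sq_of_br_eq_zero (br_self x), br_self, add_zero]
  · rw [br_add_right, br_sq_of_br_eq_zero hz, hz, add_zero]
  · rw [br_add_right, br_sq_of_br_eq_zero hu, hu, add_zero]

include h16 in
theorem Rel.y_squareCentral (r : Rel x y z u) : ∃ β : F, β ≠ 0 ∧ y ^ 2 = algebraMap F A β := by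
  obtain ⟨β, hβ⟩ : ∃ β : F, y ^ 2 = algebraMap F A β :=
    r.exists_algebraMap h16 (br_sq_of_flip r.xy) (br_sq_of_br_eq_zero (br_self y))
      (br_sq_of_br_eq_zero (br_comm y z ▸ r.yz)) (br_sq_of_br_eq_zero (br_comm y u ▸ r.yu))
  refine ⟨β, ?_, hβ⟩
  rintro rfl
  exact r.y_ne (by simpa using hβ)

/-- Standard generators are determined by their commutation relations. -/
def Rel.quad (r : Rel x y z u) : Quad F A where
  x := x
  y := y
  z := z
  u := u
  x_artinSchreier := r.x_artinSchreier h16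
  y_squareCentral := r.y_squareCentral h16
  z_artinSchreier := r.swap.x_artinSchreier h16
  u_squareCentral := r.swap.y_squareCentral h16
  x_y := r.xy
  z_u := r.zu
  x_z := br_eq_zero.mp r.xz
  x_u := br_eq_zero.mp r.xu
  y_z := br_eq_zero.mp r.yz
  y_u := br_eq_zero.mp r.yu
  generate := r.adjoin_eq_top h16

include h16 in
/-- A noncentral element with noncommutative centralizer is quadratic. -/
theorem exists_sq_eq_of_br_ne_zero {e a : A} (hx : br x e = 0) (hy : br y e = 0)
    (hxy : br x y ≠ 0) (ha : br e a ≠ 0) :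
    ∃ t n : F, e ^ 2 = algebraMap F A n + t • e := by
  have h1 := two_mul_finrank_adjoin_le (F := F) {e} x y (by simpa) (by rwa [br_comm])
  have h2 := two_mul_finrank_adjoin_le (F := F) (insert x {e}) y x
    (by rintro b (rfl | rfl); exacts [br_self _, hx]) hxy
  have h3 := two_mul_finrank_adjoin_le (F := F) (insert y (insert x {e})) a e
    (by rintro b (rfl | rfl | rfl); exacts [br_comm e b ▸ hy, br_comm e b ▸ hx, br_self _]) ha
  have h4 := finrank_adjoin_le (F := F) (insert a (insert y (insert x {e})))
  have he : ∀ c : F, e ≠ algebraMap F A c := by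
    rintro c rfl
    exact ha (by rw [br_comm, br_algebraMap])
  have h5 := two_le_finrank_adjoin_singleton he
  have hmem : e ∈ Algebra.adjoin F {e} := Algebra.subset_adjoin rfl
  let f : (F × F) →ₗ[F] Algebra.adjoin F {e} :=
    { toFun := fun p => ⟨algebraMap F A p.1 + p.2 • e,
        Subalgebra.add_mem _ (Subalgebra.algebraMap_mem _ _) (Subalgebra.smul_mem _ hmem _)⟩
      map_add' := fun p q => by ext; simp [add_smul]; abel
      map_smul' := fun r p => by ext; simp [Algebra.smul_def, mul_add, mul_assoc] }
  have hf : Function.Injective f := by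
    rw [injective_iff_map_eq_zero]
    rintro ⟨b, c⟩ hbc
    have h6 : algebraMap F A b + c • e = 0 := congrArg Subtype.val hbc
    have hc : c = 0 := by
      by_contra hc
      apply he (c⁻¹ * b)
      have : c • e = algebraMap F A b := (CharTwo.add_eq_zero.mp h6).symm
      rw [map_mul, ← this, Algebra.smul_def, ← mul_assoc, ← map_mul, inv_mul_cancel₀ hc]
      simp
    have hb : b = 0 := by simpa [hc] using h6
    simp [hb, hc]
  -- Three doublings starting from F(e) stay within dimension 16, so F(e) has dimension exactly 2
  -- and is spanned by 1 and e.
  have h7 : Module.finrank F (F × F) = Module.finrank F (Algebra.adjoin F {e}) := by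
    rw [Module.finrank_prod, Module.finrank_self]; omega
  obtain ⟨⟨n, t⟩, hnt⟩ := (LinearMap.injective_iff_surjective_of_finrank_eq_finrank h7).mp hf
    ⟨e ^ 2, Subalgebra.pow_mem _ hmem 2⟩
  exact ⟨t, n, (congrArg Subtype.val hnt).symm⟩

end Division

/-! ### Completing a standard pair to a quadruple -/

section Completion

variable [DivisionRing A] [CharP A 2] [Algebra F A] [FiniteDimensional F A]
variable {x y z u v b : A} (h16 : Module.finrank F A = 16)

/-- The centralizer of `x` is generated over that of a standard pair `x, v` by `x`. -/
theorem exists_eq_add_mul (hxv : br x v = v) (hv : ∃ β : F, v ^ 2 = algebraMap F A β)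
    (hv0 : v ≠ 0) {c : A} (hc : br x c = 0) :
    ∃ c₀ c₁ : A, br x c₀ = 0 ∧ br v c₀ = 0 ∧ br x c₁ = 0 ∧ br v c₁ = 0 ∧
      c = c₀ + (x + 1) * c₁ := by
  obtain ⟨β, hβ⟩ := hv
  obtain ⟨d, hd⟩ : ∃ d, d = v * c * v⁻¹ := ⟨_, rfl⟩
  have h1 : d * v = v * c := by rw [hd, inv_mul_cancel_right₀ hv0]
  have h2 : v * d = c * v := by
    have h3 : v * d * v = c * v * v := by
      rw [mul_assoc, h1, ← mul_assoc, mul_assoc c, ← pow_two, hβ, Algebra.commutes]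
    exact mul_right_cancel₀ hv0 h3
  have hxd : br x d = 0 := by
    rw [hd]
    exact br_mul_inv_of_flip (by rw [br_mul_right, hxv, hc]; simp) hxv
  have h4 : br v (c + d) = 0 := by
    rw [br_add_right, br_def, br_def, h1, h2]; grind
  have h5 : br x (c + d) = 0 := by rw [br_add_right, hc, hxd, add_zero]
  -- Conjugation by v swaps c and d and sends x to x + 1; both components are fixed by it.
  refine ⟨x * (c + d) + d, c + d, ?_, ?_, h5, h4, by grind⟩
  · rw [br_add_right, br_mul_right, br_self, h5, hxd]; simp
  · rw [br_add_right, br_mul_right, h4, br_comm v x, hxv, br_def, h2, mul_add, h1, h2, mul_zero,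
      add_zero, add_comm (c * v), add_self_zero]

/-- An element of the centralizer of a standard pair which is central there is central. -/
theorem exists_br_ne_zero (hx : ∃ α : F, x ^ 2 + x = algebraMap F A α) (hxv : br x v = v)
    (hv : ∃ β : F, v ^ 2 = algebraMap F A β) (hv0 : v ≠ 0) (hxb : br x b = 0) (hvb : br v b = 0)
    {a : A} (ha : br b a ≠ 0) : ∃ c, br x c = 0 ∧ br v c = 0 ∧ br b c ≠ 0 := by
  by_contra! h
  have key : ∀ c, br x c = 0 → br b c = 0 := by
    intro c hc
    obtain ⟨c₀, c₁, h1, h2, h3, h4, rfl⟩ := exists_eq_add_mul hxv hv hv0 hc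
    rw [br_add_right, br_mul_right, br_add_right, br_one_right, br_comm b x, hxb, h _ h1 h2,
      h _ h3 h4]
    simp
  apply ha
  -- Split a into a + [x,a], which commutes with x, and [x,a], which x flips and which is therefore
  -- an element commuting with x times v.
  have h1 : br b (a + br x a) = 0 :=
    key _ (by rw [br_add_right, br_br_of_artinSchreier hx, add_self_zero])
  have h2 : br b (br x a * v⁻¹) = 0 :=
    key _ (br_mul_inv_of_flip (br_br_of_artinSchreier hx a) hxv)
  have h3 : br b (br x a) = 0 := by
    rw [← inv_mul_cancel_right₀ hv0 (br x a), br_mul_right, h2, br_comm b v, hvb]; simp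
  simpa [br_add_right, h3] using h1

theorem exists_rel_of_artinSchreier (hx : ∃ α : F, x ^ 2 + x = algebraMap F A α)
    (hxv : br x v = v) (hv : ∃ β : F, v ^ 2 = algebraMap F A β) (hv0 : v ≠ 0) (hxb : br x b = 0)
    (hvb : br v b = 0) (hb : ∃ γ : F, b ^ 2 + b = algebraMap F A γ)
    {a : A} (ha : br b a ≠ 0) : ∃ u, Rel x v b u := by
  obtain ⟨c, h1, h2, h3⟩ := exists_br_ne_zero hx hxv hv hv0 hxb hvb ha
  refine ⟨br b c, hxv, br_br_of_artinSchreier hb c, hxb, ?_, hvb, ?_, hv0, h3⟩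
  · rw [br_jacobi, hxb, h1]; simp [br]
  · rw [br_jacobi, hvb, h2]; simp [br]

theorem exists_rel_of_squareCentral (hx : ∃ α : F, x ^ 2 + x = algebraMap F A α)
    (hxv : br x v = v) (hv : ∃ β : F, v ^ 2 = algebraMap F A β) (hv0 : v ≠ 0) (hxb : br x b = 0)
    (hvb : br v b = 0) (hb : ∃ γ : F, b ^ 2 = algebraMap F A γ)
    {a : A} (ha : br b a ≠ 0) : ∃ z, Rel x v z b := by
  obtain ⟨c, h1, h2, h3⟩ := exists_br_ne_zero hx hxv hv hv0 hxb hvb ha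
  have hxw : br x (br b c) = 0 := by rw [br_jacobi, hxb, h1]; simp [br]
  have hvw : br v (br b c) = 0 := by rw [br_jacobi, hvb, h2]; simp [br]
  -- As [b,c] commutes with b, the derivation [b,·] sends c[b,c]⁻¹ to 1, hence this product to b.
  refine ⟨c * (br b c)⁻¹ * b, hxv, ?_, ?_, hxb, ?_, hvb, hv0, ?_⟩
  · rw [br_comm, br_mul_right, br_mul_right, br_self,
      br_inv_of_br_eq_zero (br_br_of_squareCentral hb c), mul_inv_cancel₀ h3]
    simp
  · simp [br_mul_right, h1, hxb, br_inv_of_br_eq_zero hxw]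
  · simp [br_mul_right, h2, hvb, br_inv_of_br_eq_zero hvw]
  · rintro rfl
    exact ha (by simp [br])

/-- A noncentral quadratic element can be normalized. -/
theorem exists_normalized {e a : A} {t n : F} (h : e ^ 2 = algebraMap F A n + t • e)
    (ha : br e a ≠ 0) : ∃ b : A, (∀ w, br w e = 0 → br w b = 0) ∧ br b a ≠ 0 ∧
      ((∃ c : F, b ^ 2 + b = algebraMap F A c) ∨ ∃ c : F, b ^ 2 = algebraMap F A c) := by
  by_cases ht : t = 0
  · exact ⟨e, fun _ => id, ha, Or.inr ⟨n, by simpa [ht] using h⟩⟩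
  · refine ⟨t⁻¹ • e, fun w hw => by rw [br_smul_right, hw, smul_zero], ?_,
      Or.inl ⟨t⁻¹ ^ 2 * n, ?_⟩⟩
    · rw [br_smul_left]
      exact smul_ne_zero (inv_ne_zero ht) ha
    · rw [smul_pow, h, smul_add, smul_smul, map_mul, ← Algebra.smul_def, add_assoc, ← add_smul]
      have : t⁻¹ ^ 2 * t = t⁻¹ := by field_simp
      rw [this, add_smul, add_self_zero, add_zero]

-- The centralizer of x, v contains some e not commuting with u: otherwise the components of z from
-- `exists_eq_add_mul`, and so z itself, would commute with u. Since x and v do not commute, e is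
-- quadratic and can be normalized.
include h16 in
theorem Rel.exists_rel (r : Rel x y z u) (hxv : br x v = v)
    (hv : ∃ β : F, v ^ 2 = algebraMap F A β) (hv0 : v ≠ 0) : ∃ z' u', Rel x v z' u' := by
  obtain ⟨e, h1, h2, h3⟩ : ∃ e, br x e = 0 ∧ br v e = 0 ∧ br e u ≠ 0 := by
    by_contra! h
    obtain ⟨c₀, c₁, h1, h2, h3, h4, h5⟩ := exists_eq_add_mul hxv hv hv0 r.xz
    apply r.u_ne
    rw [← r.zu, h5, br_comm, br_add_right, br_mul_right, br_add_right, br_one_right, br_comm u x,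
      r.xu, br_comm, h _ h1 h2, br_comm, h _ h3 h4]
    simp
  obtain ⟨t, n, hn⟩ := exists_sq_eq_of_br_ne_zero h16 h1 h2 (by rwa [hxv]) h3
  obtain ⟨b, h4, h5, h6 | h6⟩ := exists_normalized hn h3
  · obtain ⟨u', hu'⟩ := exists_rel_of_artinSchreier (r.x_artinSchreier h16) hxv hv hv0 (h4 _ h1)
      (h4 _ h2) h6 h5
    exact ⟨_, _, hu'⟩
  · obtain ⟨z', hz'⟩ := exists_rel_of_squareCentral (r.x_artinSchreier h16) hxv hv hv0 (h4 _ h1)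
      (h4 _ h2) h6 h5
    exact ⟨_, _, hz'⟩

end Completion

/-! ### Composing chains, and exchanging the two pairs -/

section Chains

variable {X : Type*} {R S R' S' : X → X → Prop} {P Q T : X} {m n m' n' : ℕ}

theorem Chain.mono (h : Chain R S m n P Q) (hS : ∀ P Q, S P Q → S' P Q) (hm : m ≤ m')
    (hn : n ≤ n') : Chain R S' m' n' P Q := by
  induction h generalizing m' n' with
  | refl => exact .refl _ _ _
  | left h _ ih =>
    obtain ⟨k, rfl⟩ : ∃ k, m' = k + 1 := ⟨m' - 1, by omega⟩
    exact .left h (ih (by omega) hn)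
  | right h _ ih =>
    obtain ⟨k, rfl⟩ : ∃ k, n' = k + 1 := ⟨n' - 1, by omega⟩
    exact .right (hS _ _ h) (ih hm (by omega))

theorem Chain.trans (h : Chain R S m n P Q) (h' : Chain R S m' n' Q T) :
    Chain R S (m + m') (n + n') P T := by
  induction h with
  | refl => exact h'.mono (fun _ _ => id) (by omega) (by omega)
  | left h _ ih => rw [Nat.add_right_comm]; exact .left h (ih h')
  | right h _ ih => rw [Nat.add_right_comm]; exact .right h (ih h')

theorem ChainOf.bind {a b : ℕ} (h : ChainOf R m P Q)
    (hR : ∀ P Q, R P Q → Chain R' S' a b P Q) : Chain R' S' (m * a) (m * b) P Q := by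
  unfold ChainOf at h
  generalize (0 : ℕ) = k at h
  generalize hS : (fun _ _ : X => False) = S at h
  induction h with
  | refl => exact .refl _ _ _
  | left h _ ih =>
    rw [Nat.succ_mul, Nat.succ_mul, add_comm _ a, add_comm _ b]
    exact (hR _ _ h).trans ih
  | right h _ _ => subst hS; exact h.elim

variable {A : Type*} [Ring A] [Algebra F A]

/-- The quadruple with its two pairs interchanged. -/
def Quad.swap (p : Quad F A) : Quad F A where
  x := p.z
  y := p.u
  z := p.x
  u := p.y
  x_artinSchreier := p.z_artinSchreier
  y_squareCentral := p.u_squareCentral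
  z_artinSchreier := p.x_artinSchreier
  u_squareCentral := p.y_squareCentral
  x_y := p.z_u
  z_u := p.x_y
  x_z := p.x_z.symm
  x_u := p.y_z.symm
  y_z := p.x_u.symm
  y_u := p.y_u.symm
  generate := by
    rw [← p.generate]; congr 1; ext a
    simp only [Set.mem_insert_iff, Set.mem_singleton_iff]; tauto

theorem Quad.cls_swap (p : Quad F A) : p.swap.cls = p.cls := Sym2.eq_swap

theorem Step.intro {R : Quad F A → Quad F A → Prop} {p q : Quad F A} (h : R p q) :
    Step R p.cls q.cls := ⟨p, q, rfl, rfl, h⟩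

theorem Step.mono {R R' : Quad F A → Quad F A → Prop} (h : ∀ p q, R p q → R' p q)
    {P Q : Sym2 (A × A)} : Step R P Q → Step R' P Q
  | ⟨p, q, hp, hq, hpq⟩ => ⟨p, q, hp, hq, h p q hpq⟩

end Chains

/-! ### Π-steps, and Λ₂-steps fixing both square-central generators -/

section LambdaOneChains

variable [DivisionRing A] [CharP A 2] [Algebra F A] [FiniteDimensional F A]
variable (h16 : Module.finrank F A = 16) (p q : Quad F A)
variable {S : Sym2 (A × A) → Sym2 (A × A) → Prop} {n : ℕ}

include h16 in
/-- A change of one pair is achieved by three changes of one generator. -/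
theorem chain_of_pairChange (hz : q.z = p.z) (hu : q.u = p.u) :
    Chain (Step (F := F) LambdaOne) S 3 n p.cls q.cls := by
  have rp := p.rel
  have rq := q.rel
  rw [hz, hu] at rq
  -- A common partner v of x and x′: [x,x′], or [x′,y] when they commute. The chain changes y to v,
  -- x to x′, v to y′.
  obtain ⟨v, hv0, h1, h2, h3, h4⟩ : ∃ v, v ≠ 0 ∧ br p.x v = v ∧ br q.x v = v ∧ br v p.z = 0 ∧
      br v p.u = 0 := by
    by_cases h : br p.x q.x = 0
    · refine ⟨br q.x p.y, fun h0 => ?_, ?_, br_br_of_artinSchreier q.x_artinSchreier _, ?_, ?_⟩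
      · obtain ⟨c, hc⟩ := rp.exists_algebraMap h16 h (br_comm q.x p.y ▸ h0)
          (br_comm q.x p.z ▸ rq.xz) (br_comm q.x p.u ▸ rq.xu)
        apply rq.y_ne
        rw [← rq.xy, hc, br_comm, br_algebraMap]
      · rw [br_jacobi, h, rp.xy]; simp [br]
      · rw [br_comm, br_jacobi, br_comm p.z q.x, rq.xz, br_comm p.z p.y, rp.yz]; simp [br]
      · rw [br_comm, br_jacobi, br_comm p.u q.x, rq.xu, br_comm p.u p.y, rp.yu]; simp [br]
    · refine ⟨br p.x q.x, h, br_br_of_artinSchreier p.x_artinSchreier _, ?_, ?_, ?_⟩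
      · rw [br_comm p.x, br_br_of_artinSchreier q.x_artinSchreier]
      · rw [br_comm, br_jacobi, br_comm p.z q.x, rq.xz, br_comm p.z p.x, rp.xz]; simp [br]
      · rw [br_comm, br_jacobi, br_comm p.u q.x, rq.xu, br_comm p.u p.x, rp.xu]; simp [br]
  have r1 : Rel p.x v p.z p.u := ⟨h1, rp.zu, rp.xz, rp.xu, h3, h4, hv0, rp.u_ne⟩
  have r2 : Rel q.x v p.z p.u := ⟨h2, rp.zu, rq.xz, rq.xu, h3, h4, hv0, rp.u_ne⟩
  exact .left (Q := (r1.quad h16).cls) (.intro (.inr (.inl ⟨rfl, rfl, rfl⟩)))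
    (.left (Q := (r2.quad h16).cls) (.intro (.inl ⟨rfl, rfl, rfl⟩))
    (.left (Q := q.cls) (.intro (.inr (.inl ⟨rfl, hz, hu⟩))) (.refl _ _ _)))

include h16 in
/-- Steps preserving the two square-central generators. -/
theorem chain_of_squareCentral_eq (hy : q.y = p.y) (hu : q.u = p.u) :
    Chain (Step (F := F) LambdaOne) (Step (F := F) OmegaI) 2 1 p.cls q.cls := by
  have rp := p.rel
  have rq := q.rel
  rw [hy, hu] at rq
  have hzy : br p.z p.y = 0 := br_comm p.z p.y ▸ rp.yz
  have hux : br p.u q.x = 0 := br_comm p.u q.x ▸ rq.xu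
  have hux' : br p.u p.x = 0 := br_comm p.u p.x ▸ rp.xu
  have huy : br p.u p.y = 0 := br_comm p.u p.y ▸ rp.yu
  -- The quotient g of [x′,z] by yu commutes with y, u, z and x′. Only x may fail to commute with
  -- it: [x,g] = ky, so g + ky is scalar, and bracketing with x′ forces k = 0. The Ω_i-step with
  -- this a makes the new z commute with x′.
  obtain ⟨a, ha⟩ : ∃ a : F, br q.x p.z = a • (p.y * p.u) := by
    obtain ⟨h, hh⟩ : ∃ h, h = br q.x p.z := ⟨_, rfl⟩
    obtain ⟨g, hg⟩ : ∃ g, g = h * (p.y * p.u)⁻¹ := ⟨_, rfl⟩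
    have hyu : p.y * p.u ≠ 0 := mul_ne_zero rp.y_ne rp.u_ne
    have hgh : h = g * (p.y * p.u) := by rw [hg, inv_mul_cancel_right₀ hyu]
    have g1 : br p.y g = 0 := by
      have h1 : br p.y h = 0 := by
        rw [hh, br_jacobi, rp.yz, br_comm p.y q.x, rq.xy, rp.yz]; simp [br]
      have h2 : br p.y (p.y * p.u) = 0 := by rw [br_mul_right, br_self, rp.yu]; simp
      rw [hg, br_mul_right, h1, br_inv_of_br_eq_zero h2]; simp
    have g2 : br p.u g = 0 := by
      have h1 : br p.u h = 0 := by
        rw [hh, br_jacobi, hux, br_comm p.u p.z, rp.zu, rq.xu]; simp [br]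
      have h2 : br p.u (p.y * p.u) = 0 := by rw [br_mul_right, br_self, huy]; simp
      rw [hg, br_mul_right, h1, br_inv_of_br_eq_zero h2]; simp
    have g3 : br p.z g = 0 := by
      rw [hg]
      refine br_mul_inv_of_flip ?_ ?_
      · rw [hh, br_comm q.x, br_br_of_artinSchreier p.z_artinSchreier]
      · rw [br_mul_right, hzy, rp.zu]; simp
    have g4 : br q.x g = 0 := by
      rw [hg]
      refine br_mul_inv_of_flip ?_ ?_
      · rw [hh, br_br_of_artinSchreier q.x_artinSchreier]
      · rw [br_mul_right, rq.xy, rq.xu]; simp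
    have k1 : br p.x (br p.x g) = br p.x g := br_br_of_artinSchreier p.x_artinSchreier g
    have k2 : br p.y (br p.x g) = 0 := by
      rw [br_jacobi, br_comm p.y p.x, rp.xy, g1, br_comm p.x 0]; simp [br]
    have k3 : br p.z (br p.x g) = 0 := by rw [br_jacobi, br_comm p.z p.x, rp.xz, g3]; simp [br]
    have k4 : br p.u (br p.x g) = 0 := by rw [br_jacobi, hux', g2]; simp [br]
    obtain ⟨k, hk⟩ := rp.exists_algebraMap h16 (e := br p.x g * p.y⁻¹)
      (br_mul_inv_of_flip k1 rp.xy)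
      (by rw [br_mul_right, k2, br_inv_of_br_eq_zero (br_self _)]; simp)
      (by rw [br_mul_right, k3, br_inv_of_br_eq_zero hzy]; simp)
      (by rw [br_mul_right, k4, br_inv_of_br_eq_zero huy]; simp)
    have hk' : br p.x g = k • p.y := by
      rw [Algebra.smul_def, ← hk, inv_mul_cancel_right₀ rp.y_ne]
    obtain ⟨f, hf⟩ := rp.exists_algebraMap h16 (e := g + k • p.y)
      (by rw [br_add_right, br_smul_right, rp.xy, hk', add_self_zero])
      (by rw [br_add_right, br_smul_right, br_self, g1]; simp)
      (by rw [br_add_right, br_smul_right, hzy, g3]; simp)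
      (by rw [br_add_right, br_smul_right, huy, g2]; simp)
    have hk0 : k • p.y = 0 := by
      have := congrArg (br q.x) hf
      rwa [br_add_right, g4, br_smul_right, rq.xy, br_algebraMap, zero_add] at this
    rw [hk0, add_zero] at hf
    exact ⟨f, by rw [← hh, hgh, hf, Algebra.smul_def]⟩
  have r1 : Rel (p.x + a • (p.y * p.u)) p.y (p.z + a • (p.y * p.u)) p.u := by
    refine ⟨?_, ?_, ?_, ?_, ?_, rp.yu, rp.y_ne, rp.u_ne⟩ <;>
    simp only [br_add_right, br_add_left, br_smul_right, br_smul_left, br_mul_right, br_mul_left,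
      rp.xy, rp.xz, rp.xu, rp.yz, rp.yu, rp.zu, huy, br_self, br_comm p.u p.z] <;>
    simp [add_self_zero]
  have r2 : Rel q.x p.y (p.z + a • (p.y * p.u)) p.u := by
    refine ⟨rq.xy, r1.zu, ?_, rq.xu, r1.yz, rp.yu, rp.y_ne, rp.u_ne⟩
    rw [br_add_right, ha, br_smul_right, br_mul_right, rq.xy, rq.xu]
    simp [add_self_zero]
  exact .right (Q := (r1.quad h16).cls) (.intro ⟨a, rfl, rfl, rfl, rfl⟩)
    (.left (Q := (r2.quad h16).cls) (.intro (.inl ⟨rfl, rfl, rfl⟩))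
    (.left (Q := q.cls) (.intro (.inr (.inr (.inl ⟨rfl, hy, hu⟩)))) (.refl _ _ _)))

end LambdaOneChains

/-! ### The other Λ₂-steps -/

section LambdaTwoChains

variable [DivisionRing A] [CharP A 2] [Algebra F A] [FiniteDimensional F A]
variable {x y z u : A} (h16 : Module.finrank F A = 16) (p q : Quad F A)

theorem br_swap_eq_zero {a b : A} (h : br a b = 0) : br b a = 0 := by rwa [br_comm]

theorem br_inv_self (a : A) : br a a⁻¹ = 0 := br_inv_of_br_eq_zero (br_self a)

include h16 in
/-- The Artin-Schreier generators have a commutative centralizer. -/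
theorem Rel.br_eq_zero_of_centralizer (r : Rel x y z u) {a b : A} (hxa : br x a = 0)
    (hza : br z a = 0) (hxb : br x b = 0) (hzb : br z b = 0) : br a b = 0 := by
  by_contra h
  have hx : ∀ c : F, x ≠ algebraMap F A c := by
    rintro c rfl
    exact r.y_ne (by rw [← r.xy, br_comm, br_algebraMap])
  have h1 := two_le_finrank_adjoin_singleton hx
  have h2 := two_mul_finrank_adjoin_le (F := F) {x} z u
    (by rintro c rfl; exact br_swap_eq_zero r.xu) (by rw [br_comm, r.zu]; exact r.u_ne)
  have h3 := two_mul_finrank_adjoin_le (F := F) (insert z {x}) a b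
    (by rintro c (rfl | rfl) <;> rwa [br_comm]) (by rwa [br_comm])
  have h4 := two_mul_finrank_adjoin_le (F := F) (insert a (insert z {x})) b a
    (by rintro c (rfl | rfl | rfl); exacts [br_self _, br_swap_eq_zero hza, br_swap_eq_zero hxa]) h
  have h5 := two_mul_finrank_adjoin_le (F := F) (insert b (insert a (insert z {x}))) u z
    (by rintro c (rfl | rfl | rfl | rfl); exacts [hzb, hza, br_self _, br_swap_eq_zero r.xz])
    (by rw [r.zu]; exact r.u_ne)
  have h6 := finrank_adjoin_le (F := F) (insert u (insert b (insert a (insert z {x}))))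
  -- F(x) has dimension at least 2, and adjoining z, a, b, u doubles it four times, giving 32 > 16.
  omega

-- Commuting with yu makes [y,a]y⁻¹ and [u,a]u⁻¹ equal; the common value m is scalar, and a + m(x +
-- z) commutes with all four generators.
include h16 in
theorem Rel.exists_eq_add_smul (r : Rel x y z u) {a : A} (hx : br x a = 0) (hz : br z a = 0)
    (hyu : br (y * u) a = 0) : ∃ f m : F, a = algebraMap F A f + m • (x + z) := by
  have hy2 := r.y_squareCentral h16
  have hu2 := r.swap.y_squareCentral h16
  have hyy : br y (br y a) = 0 := br_br_of_squareCentral (hy2.imp fun _ h => h.2) a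
  have huu : br u (br u a) = 0 := br_br_of_squareCentral (hu2.imp fun _ h => h.2) a
  have hy : br y (br y a * y⁻¹) = 0 := by rw [br_mul_right, hyy, br_inv_self]; simp
  have hmu : br u a * u⁻¹ = br y a * y⁻¹ := by
    have h1 : y * br u a = br y a * u := by
      rw [br_mul_left] at hyu
      exact CharTwo.add_eq_zero.mp hyu
    have h2 : br y a * y⁻¹ * y = y * (br y a * y⁻¹) := br_eq_zero.mp (br_swap_eq_zero hy)
    rw [inv_mul_cancel_right₀ r.y_ne] at h2
    rw [mul_inv_eq_iff_eq_mul₀ r.u_ne]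
    apply mul_left_cancel₀ r.y_ne
    rw [h1, ← mul_assoc, ← h2]
  obtain ⟨m, hm⟩ := r.exists_algebraMap h16 (e := br y a * y⁻¹)
    (br_mul_inv_of_flip (by rw [br_jacobi, hx, r.xy, br_comm y 0]; simp [br]) r.xy) hy
    (by rw [br_mul_right, br_jacobi, br_comm z y, r.yz, hz,
          br_inv_of_br_eq_zero (br_swap_eq_zero r.yz)]; simp [br])
    (by rw [← hmu, br_mul_right, huu, br_inv_self]; simp)
  have hya : br y a = m • y := by rw [Algebra.smul_def, ← hm, inv_mul_cancel_right₀ r.y_ne]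
  have hua : br u a = m • u := by rw [Algebra.smul_def, ← hm, ← hmu, inv_mul_cancel_right₀ r.u_ne]
  obtain ⟨f, hf⟩ := r.exists_algebraMap h16 (e := a + m • (x + z))
    (by simp [br_add_right, br_smul_right, hx, br_self, r.xz])
    (by simp [br_add_right, br_smul_right, hya, br_comm y x, r.xy, r.yz, add_self_zero])
    (by simp [br_add_right, br_smul_right, hz, br_self, br_comm z x, r.xz])
    (by simp [br_add_right, br_smul_right, hua, br_comm u x, r.xu, br_comm u z, r.zu,
          add_self_zero])
  exact ⟨f, m, by rw [← hf, add_assoc, add_self_zero, add_zero]⟩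

include h16 in
/-- Steps preserving the two Artin-Schreier generators. -/
theorem chain_of_artinSchreier_eq (hx : q.x = p.x) (hz : q.z = p.z) :
    Chain (Step (F := F) LambdaOne) (Step (F := F) OmegaS) 2 1 p.cls q.cls := by
  have rp := p.rel
  have rq := q.rel
  rw [hx, hz] at rq
  have hzy : br p.z p.y = 0 := br_swap_eq_zero rp.yz
  have hzy' : br p.z q.y = 0 := br_swap_eq_zero rq.yz
  by_cases h0 : br q.y p.u = 0
  · have r1 : Rel p.x q.y p.z p.u := ⟨rq.xy, rp.zu, rp.xz, rp.xu, rq.yz, h0, rq.y_ne, rp.u_ne⟩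
    exact .left (Q := (r1.quad h16).cls) (.intro (.inr (.inl ⟨rfl, rfl, rfl⟩)))
      (.left (Q := q.cls) (.intro (.inr (.inr (.inr ⟨hx, rfl, hz⟩)))) (.refl _ _ _))
  obtain ⟨g, hg⟩ : ∃ g, g = q.y * p.u * (p.u * q.y)⁻¹ := ⟨_, rfl⟩
  have hgx : br p.x g = 0 := by
    rw [hg]
    exact br_mul_inv_of_flip (by rw [br_mul_right, rq.xy, rp.xu]; simp)
      (by rw [br_mul_right, rq.xy, rp.xu]; simp)
  have hgz : br p.z g = 0 := by
    rw [hg]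
    exact br_mul_inv_of_flip (by rw [br_mul_right, hzy', rp.zu]; simp)
      (by rw [br_mul_right, hzy', rp.zu]; simp)
  obtain ⟨β, -, hβ⟩ := q.y_squareCentral
  obtain ⟨δ, -, hδ⟩ := p.u_squareCentral
  -- Factor yu as (yy′⁻¹)(y′u). The first factor lies with g in the commutative centralizer of x, z;
  -- the second commutes with uy′ because u² and y′² are central.
  have hgyu : br g (p.y * p.u) = 0 := by
    have h1 : br (q.y * p.u) g = 0 := by
      have h2 : br (q.y * p.u) (p.u * q.y) = 0 := by
        rw [br_eq_zero]
        calc q.y * p.u * (p.u * q.y) = q.y * p.u ^ 2 * q.y := by simp only [pow_two, mul_assoc]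
          _ = q.y ^ 2 * p.u ^ 2 := by rw [hδ, mul_assoc, Algebra.commutes, ← mul_assoc, pow_two]
          _ = p.u * q.y ^ 2 * p.u := by
            rw [hβ, ← Algebra.commutes β p.u, mul_assoc, ← pow_two]
          _ = p.u * q.y * (q.y * p.u) := by simp only [pow_two, mul_assoc]
      rw [hg, br_mul_right, br_self, br_inv_of_br_eq_zero h2]; simp
    have h3 : br g (p.y * q.y⁻¹) = 0 :=
      rp.br_eq_zero_of_centralizer h16 hgx hgz (br_mul_inv_of_flip rp.xy rq.xy)
        (by rw [br_mul_right, hzy, br_inv_of_br_eq_zero hzy']; simp)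
    have h4 : p.y * p.u = p.y * q.y⁻¹ * (q.y * p.u) := by
      rw [mul_assoc, inv_mul_cancel_left₀ rq.y_ne]
    rw [h4, br_mul_right, h3, br_comm g, h1]; simp
  obtain ⟨f, m, hfm⟩ := rp.exists_eq_add_smul h16 hgx hgz (br_swap_eq_zero hgyu)
  obtain ⟨w, hw⟩ : ∃ w, w = algebraMap F A (1 + f) + m • (p.x + p.z) := ⟨_, rfl⟩
  have hwg : w = 1 + g := by rw [hw, hfm, map_add, map_one, add_assoc]
  have hwx : br p.x w = 0 := by rw [hwg, br_add_right, br_one_right, hgx, add_zero]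
  have hwz : br p.z w = 0 := by rw [hwg, br_add_right, br_one_right, hgz, add_zero]
  have hwy : br p.y w = m • p.y := by
    simp [hw, br_add_right, br_smul_right, br_algebraMap, br_comm p.y p.x, rp.xy, rp.yz,
      -map_add]
  have hwu : br w p.u = m • p.u := by
    rw [br_comm]
    simp [hw, br_add_right, br_smul_right, br_algebraMap, br_comm p.u p.x, rp.xu, br_comm p.u p.z,
      rp.zu, -map_add]
  -- So wu is u plus its conjugate by y′, which commutes with y′ as y′² is central. After the
  -- Ω_s-step by w, y can be replaced by y′.
  have hwu' : w * p.u = p.u + q.y * p.u * q.y⁻¹ := by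
    rw [hwg, hg, mul_inv_rev, add_mul, one_mul, mul_assoc, inv_mul_cancel_right₀ rp.u_ne]
  have hw0 : w ≠ 0 := by
    intro hw0
    apply h0
    rw [hwg] at hw0
    have h1 := CharTwo.add_eq_zero.mp hw0
    rw [hg, eq_mul_inv_iff_mul_eq₀ (mul_ne_zero rp.u_ne rq.y_ne), one_mul] at h1
    exact br_eq_zero.mpr h1.symm
  have r1 : Rel p.x (w * p.y) p.z (w * p.u) := by
    refine ⟨?_, ?_, rp.xz, ?_, ?_, ?_, mul_ne_zero hw0 rp.y_ne, mul_ne_zero hw0 rp.u_ne⟩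
    · rw [br_mul_right, hwx, rp.xy]; simp
    · rw [br_mul_right, hwz, rp.zu]; simp
    · rw [br_mul_right, hwx, rp.xu]; simp
    · rw [br_comm, br_mul_right, hwz, hzy]; simp
    · rw [br_mul_right, br_mul_left, br_mul_left, br_self, hwy, hwu, rp.yu]
      simp [mul_assoc, p.y_u, add_self_zero]
  have r2 : Rel p.x q.y p.z (w * p.u) := by
    refine ⟨rq.xy, r1.zu, rp.xz, r1.xu, rq.yz, ?_, rq.y_ne, r1.u_ne⟩
    have h1 : q.y * (q.y * p.u * q.y⁻¹) = p.u * q.y := by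
      rw [← mul_assoc, ← mul_assoc, ← pow_two, hβ, Algebra.commutes, ← hβ, pow_two, ← mul_assoc,
        mul_inv_cancel_right₀ rq.y_ne]
    rw [br_eq_zero, hwu', mul_add, add_mul, h1, inv_mul_cancel_right₀ rq.y_ne, add_comm]
  exact .right (Q := (r1.quad h16).cls)
      (.intro ⟨1 + f, m, rfl, rfl, by rw [← hw]; rfl, by rw [← hw]; rfl⟩)
    (.left (Q := (r2.quad h16).cls) (.intro (.inr (.inl ⟨rfl, rfl, rfl⟩)))
    (.left (Q := q.cls) (.intro (.inr (.inr (.inr ⟨hx, rfl, hz⟩)))) (.refl _ _ _)))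

include h16 in
/-- Steps preserving one generator of each kind, generic case. -/
theorem chain_of_mixed_eq_of_ne (hy : q.y = p.y) (hz : q.z = p.z)
    (h0 : p.x * q.u + q.u * p.x ≠ q.u) :
    Chain (Step (F := F) LambdaOne) (Step (F := F) OmegaC) 2 1 p.cls q.cls := by
  have rp := p.rel
  have rq := q.rel
  rw [hy, hz] at rq
  have hzx : br p.z p.x = 0 := br_swap_eq_zero rp.xz
  have hyx : br p.y p.x = p.y := br_comm p.x p.y ▸ rp.xy
  have hzy : br p.z p.y = 0 := br_swap_eq_zero rp.yz
  obtain ⟨h, hh⟩ : ∃ h, h = br p.x q.u := ⟨_, rfl⟩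
  -- The component of u′ commuting with x. It is nonzero by `h0`, so it can replace u, and u′ turns
  -- out to be (1 + by)w.
  obtain ⟨w, hw⟩ : ∃ w, w = q.u + h := ⟨_, rfl⟩
  have hw0 : w ≠ 0 := fun hw0 => h0 (by
    rw [hw] at hw0
    exact hh.symm.trans (CharTwo.add_eq_zero.mp hw0).symm)
  have hxh : br p.x h = h := by rw [hh, br_br_of_artinSchreier p.x_artinSchreier]
  have hyh : br p.y h = 0 := by rw [hh, br_jacobi, hyx, rq.yu]; simp [br]
  have hzh : br p.z h = h := by rw [hh, br_jacobi, hzx, rq.zu]; simp [br]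
  have r1 : Rel p.x p.y p.z w := by
    refine ⟨rp.xy, ?_, rp.xz, ?_, rp.yz, ?_, rp.y_ne, hw0⟩
    · rw [hw, br_add_right, rq.zu, hzh]
    · rw [hw, br_add_right, hxh, ← hh, add_self_zero]
    · rw [hw, br_add_right, rq.yu, hyh, add_zero]
  obtain ⟨b, hb⟩ : ∃ b : F, h = b • p.y * w := by
    obtain ⟨g, hg⟩ : ∃ g, g = h * p.y⁻¹ := ⟨_, rfl⟩
    have hxg : br p.x g = 0 := by rw [hg]; exact br_mul_inv_of_flip hxh rp.xy
    have hyg : br p.y g = 0 := by rw [hg, br_mul_right, hyh, br_inv_self]; simp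
    have hzg : br p.z g = g := by
      rw [hg, br_mul_right, hzh, br_inv_of_br_eq_zero hzy]; simp
    have hgh : h = p.y * g := by
      rw [br_eq_zero.mp hyg, hg, inv_mul_cancel_right₀ rp.y_ne]
    by_cases hg0 : g = 0
    · exact ⟨0, by simp [hgh, hg0]⟩
    have r2 : Rel p.x p.y p.z g := ⟨rp.xy, hzg, rp.xz, hxg, rp.yz, hyg, rp.y_ne, hg0⟩
    -- The squares of u′ = w + yg, of w and of yg are scalars, hence so is the cross term y[w,g]. As
    -- x flips this term, it vanishes.
    have hwg : br w g = 0 := by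
      obtain ⟨β, -, hβ⟩ := p.y_squareCentral
      obtain ⟨δ, -, hδ⟩ := q.u_squareCentral
      obtain ⟨ε, -, hε⟩ := r1.swap.y_squareCentral h16
      obtain ⟨ζ, -, hζ⟩ := r2.swap.y_squareCentral h16
      have h1 : q.u = w + p.y * g := by rw [← hgh, hw, add_assoc, add_self_zero, add_zero]
      have h2 : (p.y * g) ^ 2 = p.y ^ 2 * g ^ 2 :=
        (show Commute p.y g from br_eq_zero.mp hyg).mul_pow 2
      have h3 : q.u ^ 2 = w ^ 2 + (p.y * g) ^ 2 + br w (p.y * g) := by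
        rw [h1]; simp only [br]; grind
      have h4 : br w (p.y * g) = p.y * br w g := by
        rw [br_mul_right, br_comm w p.y, r1.yu]; simp
      rw [h2, hδ, hε, hβ, hζ, ← map_mul, ← map_add, h4] at h3
      have h5 := congrArg (br p.x) h3
      rw [br_add_right, br_algebraMap, br_algebraMap, br_mul_right, rp.xy, br_jacobi, r1.xu,
        hxg] at h5
      have h6 : p.y * br w g = 0 := by simpa [br] using h5.symm
      exact (mul_eq_zero.mp h6).resolve_left rp.y_ne
    obtain ⟨b, hb⟩ := r1.exists_algebraMap h16 (e := g * w⁻¹)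
      (by rw [br_mul_right, hxg, br_inv_of_br_eq_zero r1.xu]; simp)
      (by rw [br_mul_right, hyg, br_inv_of_br_eq_zero r1.yu]; simp)
      (br_mul_inv_of_flip hzg r1.zu)
      (by rw [br_mul_right, hwg, br_inv_self]; simp)
    refine ⟨b, ?_⟩
    rw [mul_inv_eq_iff_eq_mul₀ hw0] at hb
    rw [hgh, hb, ← mul_assoc, ← Algebra.commutes, Algebra.smul_def]
  have hu : q.u = (1 + b • p.y) * w := by
    rw [add_mul, one_mul, ← hb, hw, add_assoc, add_self_zero, add_zero]
  have hk0 : 1 + b • p.y ≠ 0 := fun hk0 => rq.u_ne (by rw [hu, hk0, zero_mul])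
  obtain ⟨k, hk⟩ : ∃ k, k = b • p.y * (1 + b • p.y)⁻¹ := ⟨_, rfl⟩
  have key : ∀ a, br a p.y = 0 → br a k = 0 := fun a ha => by
    have h1 : br a (1 + b • p.y) = 0 := by rw [br_add_right, br_smul_right, ha, br_one_right]; simp
    rw [hk, br_mul_right, br_inv_of_br_eq_zero h1, br_smul_right, ha]; simp
  have hkyu : k * q.u = h := by
    rw [hk, hu, ← mul_assoc, inv_mul_cancel_right₀ hk0, hb]
  have r2 : Rel (p.x + k * p.z) p.y p.z q.u := by
    refine ⟨?_, rq.zu, ?_, ?_, rp.yz, rq.yu, rp.y_ne, rq.u_ne⟩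
    · rw [br_add_left, rp.xy, br_mul_left, hzy, br_comm k, key _ (br_self _)]; simp
    · rw [br_add_left, rp.xz, br_mul_left, br_self, br_comm k, key _ hzy]; simp
    · rw [br_add_left, br_mul_left, rq.zu, br_comm k, key _ (br_swap_eq_zero rq.yu), hkyu, ← hh]
      simp [add_self_zero]
  exact .left (Q := (r1.quad h16).cls) (.intro (.inr (.inr (.inr ⟨rfl, rfl, rfl⟩))))
    (.right (Q := (r2.quad h16).cls) (.intro ⟨b, rfl, rfl, congrArg (p.x + · * p.z) hk, hu⟩)
    (.left (Q := q.cls) (.intro (.inl ⟨hy, hz, rfl⟩)) (.refl _ _ _)))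

include h16 in
/-- Steps preserving one generator of each kind. -/
theorem chain_of_mixed_eq (hy : q.y = p.y) (hz : q.z = p.z) :
    Chain (Step (F := F) LambdaOne) (Step (F := F) OmegaC) 7 1 p.cls q.cls := by
  by_cases h0 : p.x * q.u + q.u * p.x = q.u
  swap
  · exact (chain_of_mixed_eq_of_ne h16 p q hy hz h0).mono (fun _ _ => id) (by norm_num) le_rfl
  have hxu : br p.x q.u = q.u := h0
  have rp := p.rel
  have rq := q.rel
  rw [hy, hz] at rq
  have hzx : br p.z p.x = 0 := br_swap_eq_zero rp.xz
  have hzy : br p.z p.y = 0 := br_swap_eq_zero rp.yz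
  have hy1 : p.y + 1 ≠ 0 := fun h => rp.y_ne (by
    rw [← rp.xy, CharTwo.add_eq_zero.mp h, br_one_right])
  have hinv : ∀ a, br a p.y = 0 → br a p.y⁻¹ = 0 := fun a => br_inv_of_br_eq_zero
  have e1 : p.y * p.y⁻¹ = 1 := mul_inv_cancel₀ rp.y_ne
  have hyb : ∀ a, br a p.y = 0 → br a (p.y + 1) = 0 := fun a ha => by
    rw [br_add_right, ha, br_one_right, add_zero]
  have hx1y : br (p.x + p.x * p.y⁻¹) p.y = p.y + 1 := by
    rw [br_add_left, br_mul_left, rp.xy, br_comm _ p.y, br_inv_self, e1]; simp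
  -- In this degenerate case u′ has no component commuting with x. Replacing y by y + 1 makes the
  -- Ω_c-step with b = 1 multiply u by 1 + (y + 1) = y; its new x commutes with u′, so u′ can be
  -- inserted at once. Two Π-steps around this cost 3 + 1 + 3 Λ₁-steps.
  have r1 : Rel (p.x + p.x * p.y⁻¹) (p.y + 1) p.z p.u := by
    refine ⟨?_, rp.zu, ?_, ?_, ?_, ?_, hy1, rp.u_ne⟩
    · rw [br_add_right, hx1y, br_one_right, add_zero]
    · rw [br_comm, br_add_right, br_mul_right, hzx, hinv _ hzy]; simp
    · rw [br_comm, br_add_right, br_mul_right, br_comm, rp.xu, hinv _ (br_swap_eq_zero rp.yu)]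
      simp
    · rw [br_comm]; exact hyb _ hzy
    · rw [br_comm]; exact hyb _ (br_swap_eq_zero rp.yu)
  have e2 : 1 + (p.y + 1) = p.y := by rw [add_comm p.y, ← add_assoc, add_self_zero, zero_add]
  obtain ⟨k, hk⟩ : ∃ k, k = (p.y + 1) * p.y⁻¹ := ⟨_, rfl⟩
  have key : ∀ a, br a p.y = 0 → br k a = 0 := fun a ha => by
    rw [br_comm, hk, br_mul_right, hyb _ ha, hinv _ ha]; simp
  have hk1 : k = 1 + p.y⁻¹ := by rw [hk, add_mul, e1, one_mul]
  have hxy' : br (p.x + p.x * p.y⁻¹ + k * p.z) (p.y + 1) = p.y + 1 := by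
    rw [br_add_left, r1.xy, br_mul_left, hyb _ hzy, key _ (br_swap_eq_zero (hyb _ (br_self _)))]
    simp
  have hxz' : br (p.x + p.x * p.y⁻¹ + k * p.z) p.z = 0 := by
    rw [br_add_left, r1.xz, br_mul_left, br_self, key _ hzy]; simp
  have r2 : Rel (p.x + p.x * p.y⁻¹ + k * p.z) (p.y + 1) p.z (p.y * p.u) := by
    refine ⟨hxy', ?_, hxz', ?_, r1.yz, ?_, hy1, mul_ne_zero rp.y_ne rp.u_ne⟩
    · rw [br_mul_right, hzy, rp.zu]; simp
    · rw [br_mul_right, br_add_left, hx1y, br_add_left, r1.xu, br_mul_left, br_mul_left, hzy,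
        rp.zu, key _ (br_self _), key _ (br_swap_eq_zero rp.yu), hk1]
      simp only [mul_add, add_mul, ← mul_assoc, e1]
      simp
      grind
    · rw [br_mul_right, r1.yu, br_comm _ p.y, hyb _ (br_self _)]; simp
  have r3 : Rel (p.x + p.x * p.y⁻¹ + k * p.z) (p.y + 1) p.z q.u := by
    refine ⟨hxy', rq.zu, hxz', ?_, r1.yz, ?_, hy1, rq.u_ne⟩
    · rw [br_add_left, br_add_left, br_mul_left, br_mul_left, hxu, rq.zu,
        key _ (br_swap_eq_zero rq.yu), br_comm p.y⁻¹, hinv _ (br_swap_eq_zero rq.yu), hk1]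
      have := br_eq_zero.mp (hinv _ (br_swap_eq_zero rq.yu))
      simp only [add_mul, one_mul, this, mul_zero, zero_mul, zero_add, add_zero]
      exact add_self_zero _
    · rw [br_comm]; exact hyb _ (br_swap_eq_zero rq.yu)
  have h1 : Chain (Step (F := F) LambdaOne) (Step (F := F) OmegaC) 3 0 p.cls (r1.quad h16).cls :=
    chain_of_pairChange h16 _ _ rfl rfl
  have h2 : Chain (Step (F := F) LambdaOne) (Step (F := F) OmegaC) 3 0 (r3.quad h16).cls q.cls :=
    chain_of_pairChange h16 _ _ hz rfl
  refine h1.trans (m' := 4) (n' := 1) (.right (Q := (r2.quad h16).cls)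
    (.intro ⟨1, rfl, rfl, ?_, ?_⟩) (.left (Q := (r3.quad h16).cls)
    (.intro (.inr (.inr (.inr ⟨rfl, rfl, rfl⟩)))) h2))
  · change _ = p.x + p.x * p.y⁻¹ + (1 : F) • (p.y + 1) * (1 + (1 : F) • (p.y + 1))⁻¹ * p.z
    rw [one_smul, e2, ← hk]; rfl
  · change _ = (1 + (1 : F) • (p.y + 1)) * p.u
    rw [one_smul, e2]; rfl

end LambdaTwoChains

/-! ### Splitting Λ₃-steps, and connecting quadruples by them -/

section LambdaThreeSteps

variable [DivisionRing A] [CharP A 2] [Algebra F A] [FiniteDimensional F A]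
variable {x y z u : A} (h16 : Module.finrank F A = 16) (p q : Quad F A)

theorem Quad.y_sq (p : Quad F A) : ∃ β : F, p.y ^ 2 = algebraMap F A β :=
  p.y_squareCentral.imp fun _ h => h.2

include h16 in
/-- In the centralizer of a standard pair, what anticommutes with some element is
square-central. -/
theorem exists_sq_eq_of_flip {v : A} (hxy : br x y ≠ 0) (hx : br x v = 0) (hy : br y v = 0)
    (hz : br z v = v) (hv : v ≠ 0) : ∃ β : F, v ^ 2 = algebraMap F A β := by
  obtain ⟨t, n, h⟩ := exists_sq_eq_of_br_ne_zero h16 hx hy hxy (a := z) (by rwa [br_comm, hz])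
  have h1 := congrArg (br z) h
  rw [br_sq_of_flip hz, br_add_right, br_algebraMap, br_smul_right, hz, zero_add] at h1
  exact ⟨n, by rw [h, ← h1, add_zero]⟩

-- The intermediate quadruples are (x₁,y,z,v) and (x′,y,z₂,v), where v commutes with x′ and y and is
-- flipped by z. If [x′,z] ≠ 0, then v = [x′,z]y⁻¹ works; otherwise z completes the pair (x′,y).
include h16 in
theorem exists_lambdaTwo_of_y_eq (hy : q.y = p.y) : ∃ p₁ p₂ : Quad F A, p₁.y = p.y ∧ p₁.z = p.z ∧
    p₂.y = p₁.y ∧ p₂.u = p₁.u ∧ q.x = p₂.x ∧ q.y = p₂.y := by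
  have rp := p.rel
  have rq := q.rel
  rw [hy] at rq
  have hzy : br p.z p.y = 0 := br_swap_eq_zero rp.yz
  obtain ⟨v, hv0, h1, h2, h3⟩ : ∃ v, v ≠ 0 ∧ br q.x v = 0 ∧ br p.y v = 0 ∧ br p.z v = v := by
    by_cases h : br q.x p.z = 0
    · obtain ⟨v, hv⟩ := exists_rel_of_artinSchreier q.x_artinSchreier rq.xy p.y_sq rp.y_ne h rp.yz
        p.z_artinSchreier (a := p.u) (by rw [rp.zu]; exact rp.u_ne)
      exact ⟨v, hv.u_ne, hv.xu, hv.yu, hv.zu⟩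
    · refine ⟨br q.x p.z * p.y⁻¹, mul_ne_zero h (inv_ne_zero rp.y_ne), ?_, ?_, ?_⟩
      · exact br_mul_inv_of_flip (br_br_of_artinSchreier q.x_artinSchreier _) rq.xy
      · rw [br_mul_right, br_jacobi, rp.yz, br_comm p.y q.x, rq.xy, rp.yz, br_inv_self]; simp [br]
      · rw [br_mul_right, br_comm q.x, br_br_of_artinSchreier p.z_artinSchreier,
          br_inv_of_br_eq_zero hzy]; simp
  have hv := exists_sq_eq_of_flip h16 (by rw [rq.xy]; exact rp.y_ne) h1 h2 h3 hv0
  obtain ⟨z₂, r2⟩ := exists_rel_of_squareCentral q.x_artinSchreier rq.xy p.y_sq rp.y_ne h1 h2 hv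
    (a := p.z) (by rwa [br_comm, h3])
  obtain ⟨x₁, r1⟩ := exists_rel_of_squareCentral p.z_artinSchreier h3 hv hv0 hzy
    (br_swap_eq_zero h2) p.y_sq (a := p.x) (by rw [br_comm, rp.xy]; exact rp.y_ne)
  exact ⟨r1.swap.quad h16, r2.quad h16, rfl, rfl, rfl, rfl, rfl, hy⟩

-- Here v must commute with x and y′ and be flipped by z. Conjugation by y′ swaps z with d =
-- y′zy′⁻¹, so v = [z,d] works if nonzero.
include h16 in
theorem exists_lambdaTwo_of_x_eq (hx : q.x = p.x) : ∃ p₁ p₂ : Quad F A, p₁.x = p.x ∧ p₁.z = p.z ∧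
    p₂.x = p₁.x ∧ p₂.u = p₁.u ∧ q.x = p₂.x ∧ q.y = p₂.y := by
  have rp := p.rel
  have rq := q.rel
  rw [hx] at rq
  have hzx : br p.z p.x = 0 := br_swap_eq_zero rp.xz
  obtain ⟨v, hv0, h1, h2, h3⟩ : ∃ v, v ≠ 0 ∧ br p.x v = 0 ∧ br q.y v = 0 ∧ br p.z v = v := by
    obtain ⟨d, hd⟩ : ∃ d, d = q.y * p.z * q.y⁻¹ := ⟨_, rfl⟩
    have hdy : d * q.y = q.y * p.z := by rw [hd, inv_mul_cancel_right₀ rq.y_ne]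
    obtain ⟨β, hβ⟩ := q.y_sq
    have hyd : q.y * d = p.z * q.y := by
      apply mul_right_cancel₀ rq.y_ne
      rw [mul_assoc, hdy, ← mul_assoc, mul_assoc p.z, ← pow_two, hβ, Algebra.commutes]
    have hxd : br p.x d = 0 := by
      rw [hd]
      exact br_mul_inv_of_flip (by rw [br_mul_right, rq.xy, rp.xz]; simp) rq.xy
    by_cases h : br p.z d = 0
    · obtain ⟨γ, hγ⟩ := p.z_artinSchreier
      have hd2 : d ^ 2 + d = algebraMap F A γ := by
        have h4 : q.y * (p.z ^ 2 + p.z) * q.y⁻¹ = d ^ 2 + d := by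
          rw [mul_add, add_mul, ← hd, pow_two d]
          congr 1
          rw [hd]
          simp only [pow_two, mul_assoc]
          rw [inv_mul_cancel_left₀ rq.y_ne]
        rw [← h4, hγ, ← Algebra.commutes, mul_inv_cancel_right₀ rq.y_ne]
      -- Commuting roots of one Artin-Schreier polynomial: d is z or z + 1. Then z, respectively z +
      -- x, commutes with y′ and completes the pair (x,y′).
      have hprod : (p.z + d) * (p.z + d + 1) = 0 := by
        have h4 : (p.z + d) * (p.z + d + 1) = (p.z ^ 2 + p.z) + (d ^ 2 + d) + br p.z d := by
          simp only [br]; grind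
        rw [h4, hγ, hd2, h, add_self_zero, add_zero]
      rcases mul_eq_zero.mp hprod with h5 | h5
      · have h6 : d = p.z := (CharTwo.add_eq_zero.mp h5).symm
        obtain ⟨v, hv⟩ := exists_rel_of_artinSchreier p.x_artinSchreier rq.xy q.y_sq rq.y_ne rp.xz
          (by rw [br_eq_zero, ← hdy, h6]) p.z_artinSchreier (a := p.u)
          (by rw [rp.zu]; exact rp.u_ne)
        exact ⟨v, hv.u_ne, hv.xu, hv.yu, hv.zu⟩
      · have h6 : d = p.z + 1 := by
          rw [add_right_comm] at h5
          exact (CharTwo.add_eq_zero.mp h5).symm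
        have h7 : br q.y (p.z + p.x) = 0 := by
          rw [br_add_right, br_comm q.y p.x, rq.xy, br_def, ← hdy, h6]
          grind
        have h8 : ∃ c : F, (p.z + p.x) ^ 2 + (p.z + p.x) = algebraMap F A c := by
          obtain ⟨α, hα⟩ := p.x_artinSchreier
          refine ⟨γ + α, ?_⟩
          have h9 : (p.z + p.x) ^ 2 + (p.z + p.x) =
              (p.z ^ 2 + p.z) + (p.x ^ 2 + p.x) + br p.z p.x := by simp only [br]; grind
          rw [h9, hzx, hγ, hα, map_add, add_zero]
        obtain ⟨v, hv⟩ := exists_rel_of_artinSchreier p.x_artinSchreier rq.xy q.y_sq rq.y_ne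
          (by rw [br_add_right, rp.xz, br_self, add_zero]) h7 h8 (a := p.u)
          (by rw [br_add_left, rp.zu, rp.xu, add_zero]; exact rp.u_ne)
        refine ⟨v, hv.u_ne, hv.xu, hv.yu, ?_⟩
        have := hv.zu
        rwa [br_add_left, hv.xu, add_zero] at this
    · refine ⟨br p.z d, h, ?_, ?_, br_br_of_artinSchreier p.z_artinSchreier _⟩
      · rw [br_jacobi, rp.xz, hxd]; simp [br]
      · rw [br_eq_zero, br_def, mul_add, add_mul, ← mul_assoc, ← mul_assoc, ← hdy, hyd,
          mul_assoc d, hyd, mul_assoc p.z, ← hdy]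
        grind
  have hv := exists_sq_eq_of_flip h16 (by rw [rq.xy]; exact rq.y_ne) h1 h2 h3 hv0
  obtain ⟨z₂, r2⟩ := exists_rel_of_squareCentral p.x_artinSchreier rq.xy q.y_sq rq.y_ne h1 h2 hv
    (a := p.z) (by rwa [br_comm, h3])
  obtain ⟨y₁, r1⟩ := exists_rel_of_artinSchreier p.z_artinSchreier h3 hv hv0 hzx
    (br_swap_eq_zero h1) p.x_artinSchreier (a := p.y) (by rw [rp.xy]; exact rp.y_ne)
  exact ⟨r1.swap.quad h16, r2.quad h16, rfl, rfl, rfl, rfl, hx, rfl⟩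

theorem br_inv_right (b : A) (hy : y ≠ 0) : br b y⁻¹ = y⁻¹ * br b y * y⁻¹ := by
  rw [br_def, br_def, mul_add, add_mul, mul_assoc, mul_assoc y⁻¹, mul_assoc b,
    mul_inv_cancel₀ hy, mul_assoc y, inv_mul_cancel_left₀ hy, mul_one, add_comm]

theorem br_br_mul_inv (b : A) (hy : y ≠ 0) :
    br b (br b y * y⁻¹) = br b (br b y) * y⁻¹ + (br b y * y⁻¹) ^ 2 := by
  rw [br_mul_right, br_inv_right b hy, pow_two]
  simp only [mul_assoc]

theorem mul_sq_of_br_eq_zero {c : A} (h : br y c = 0) (hc : ∃ n : F, c ^ 2 = algebraMap F A n)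
    (hy : ∃ β : F, y ^ 2 = algebraMap F A β) : ∃ n : F, (c * y) ^ 2 = algebraMap F A n := by
  obtain ⟨n, hn⟩ := hc
  obtain ⟨β, hβ⟩ := hy
  exact ⟨n * β, by
    rw [(show Commute c y from (br_eq_zero.mp h).symm).mul_pow, hn, hβ, map_mul]⟩

-- Such a c is quadratic, c² = n + tc, and [b,·] turns this into t[b,c] = 0.
include h16 in
theorem Rel.sq_of_br_eq (r : Rel x y z u) {b c : A} (hx : br x c = 0) (hy : br y c = 0)
    (hbc : br b c ≠ 0) (hb : br b (c ^ 2) = 0) : ∃ n : F, c ^ 2 = algebraMap F A n := by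
  obtain ⟨t, n, h⟩ := exists_sq_eq_of_br_ne_zero h16 hx hy (by rw [r.xy]; exact r.y_ne)
    (a := b) (by rwa [br_comm])
  rw [h, br_add_right, br_algebraMap, br_smul_right, zero_add, smul_eq_zero] at hb
  exact ⟨n, by rw [h, hb.resolve_right hbc]; simp⟩

include h16 in
/-- Commuting Artin-Schreier elements are contained in a common quadruple. -/
theorem Rel.exists_rel_of_commute_artinSchreier (r : Rel x y z u) {b a : A} (hxb : br x b = 0)
    (hb : ∃ γ : F, b ^ 2 + b = algebraMap F A γ) (ha : br b a ≠ 0) :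
    (∃ y' u', Rel x y' b u') ∨ ∃ c : F, b + x = algebraMap F A c := by
  have hxAS := r.x_artinSchreier h16
  have hysq : ∃ β : F, y ^ 2 = algebraMap F A β := (r.y_squareCentral h16).imp fun _ h => h.2
  have hbb : br b (br b y) = br b y := br_br_of_artinSchreier hb y
  by_cases h1 : y + br b y = 0
  · have hby : br b y = y := (CharTwo.add_eq_zero.mp h1).symm
    by_cases h2 : ∀ d, br (b + x) d = 0
    · right
      exact r.exists_algebraMap h16 (br_swap_eq_zero (h2 _)) (br_swap_eq_zero (h2 _))
        (br_swap_eq_zero (h2 _)) (br_swap_eq_zero (h2 _))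
    · push Not at h2
      obtain ⟨d, hd⟩ := h2
      left
      have h3 : ∃ c : F, (b + x) ^ 2 + (b + x) = algebraMap F A c := by
        obtain ⟨α, hα⟩ := hxAS
        obtain ⟨γ, hγ⟩ := hb
        refine ⟨γ + α, ?_⟩
        have h9 : (b + x) ^ 2 + (b + x) = (b ^ 2 + b) + (x ^ 2 + x) + br x b := by
          simp only [br]; grind
        rw [h9, hxb, hγ, hα, map_add, add_zero]
      have hyb : br y (b + x) = 0 := by
        rw [br_add_right, br_comm, hby, br_comm, r.xy, add_self_zero]
      obtain ⟨v, hv⟩ := exists_rel_of_artinSchreier hxAS r.xy hysq r.y_ne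
        (by rw [br_add_right, hxb, br_self, add_zero]) hyb h3 hd
      have hbv : br b v = v := by
        have := hv.zu
        rwa [br_add_left, hv.xu, add_zero] at this
      -- Both y and v are flipped by b, so yv commutes with b, while x still flips it.
      refine ⟨y * v, v, ?_, hbv, hxb, hv.xu, ?_, ?_, mul_ne_zero r.y_ne hv.u_ne, hv.u_ne⟩
      · rw [br_mul_right, r.xy, hv.xu]; simp
      · rw [br_comm, br_mul_right, hby, hbv, add_self_zero]
      · rw [br_comm, br_mul_right, br_self, br_comm, hv.yu]; simp
  · left
    -- The new partner of x is y + [b,y] = (1 + c)y, which commutes with b. From [b,c] = c + c²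
    -- follows [b,c²] = 0, so its square is scalar.
    obtain ⟨c, hc⟩ : ∃ c, c = br b y * y⁻¹ := ⟨_, rfl⟩
    have hcy : c * y = br b y := by rw [hc, inv_mul_cancel_right₀ r.y_ne]
    have hxby : br x (br b y) = br b y := by rw [br_jacobi, hxb, r.xy]; simp [br]
    have hxc : br x c = 0 := by rw [hc]; exact br_mul_inv_of_flip hxby r.xy
    have hyc : br y c = 0 := by
      rw [hc, br_mul_right, br_comm b y, br_br_of_squareCentral hysq, br_inv_self]; simp
    have hbc : br b c = c + c ^ 2 := by rw [hc, br_br_mul_inv b r.y_ne, hbb]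
    have hy1 : (1 + c) * y = y + br b y := by rw [add_mul, one_mul, hcy]
    have hsq : ∃ n : F, (1 + c) ^ 2 = algebraMap F A n := by
      by_cases h2 : br b c = 0
      · have h3 : c * (1 + c) = 0 := by rw [mul_add, mul_one, ← pow_two, ← hbc, h2]
        rcases mul_eq_zero.mp h3 with h4 | h4
        · exact ⟨1, by simp [h4]⟩
        · exact absurd (by rw [← hy1, h4, zero_mul]) h1
      · obtain ⟨n, hn⟩ := r.sq_of_br_eq h16 hxc hyc h2 (by
          rw [pow_two, br_mul_right, hbc]; grind)
        refine ⟨1 + n, ?_⟩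
        rw [map_add, map_one, ← hn]; grind
    have hsq1 := mul_sq_of_br_eq_zero
      (by rw [br_add_right, br_one_right, hyc, add_zero]) hsq hysq
    rw [hy1] at hsq1
    obtain ⟨u', hu'⟩ := exists_rel_of_artinSchreier hxAS (by rw [br_add_right, r.xy, hxby]) hsq1 h1
      hxb (by rw [br_comm, br_add_right, hbb, add_self_zero]) hb ha
    exact ⟨_, u', hu'⟩

include h16 in
/-- An Artin-Schreier element and a square-central element commuting with it are contained in
a common quadruple. -/
theorem Rel.exists_rel_of_commute_squareCentral (r : Rel x y z u) {b a : A} (hxb : br x b = 0)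
    (hb : ∃ γ : F, b ^ 2 = algebraMap F A γ) (ha : br b a ≠ 0) : ∃ y' z', Rel x y' z' b := by
  have hxAS := r.x_artinSchreier h16
  have hysq : ∃ β : F, y ^ 2 = algebraMap F A β := (r.y_squareCentral h16).imp fun _ h => h.2
  have hbb : br b (br b y) = 0 := br_br_of_squareCentral hb y
  by_cases h1 : br b y = 0
  · obtain ⟨z', hz'⟩ := exists_rel_of_squareCentral hxAS r.xy hysq r.y_ne hxb
      (br_swap_eq_zero h1) hb ha
    exact ⟨_, z', hz'⟩
  · obtain ⟨c, hc⟩ : ∃ c, c = br b y * y⁻¹ := ⟨_, rfl⟩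
    have hcy : c * y = br b y := by rw [hc, inv_mul_cancel_right₀ r.y_ne]
    have hxby : br x (br b y) = br b y := by rw [br_jacobi, hxb, r.xy]; simp [br]
    have hxc : br x c = 0 := by rw [hc]; exact br_mul_inv_of_flip hxby r.xy
    have hyc : br y c = 0 := by
      rw [hc, br_mul_right, br_comm b y, br_br_of_squareCentral hysq, br_inv_self]; simp
    have hbc : br b c = c ^ 2 := by rw [hc, br_br_mul_inv b r.y_ne, hbb]; simp
    have hc0 : c ≠ 0 := by rw [hc]; exact mul_ne_zero h1 (inv_ne_zero r.y_ne)
    have hsq := r.sq_of_br_eq (F := F) (b := b) h16 hxc hyc (by rw [hbc]; exact pow_ne_zero 2 hc0)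
      (by rw [pow_two, br_mul_right, hbc]; grind)
    have hsq1 := mul_sq_of_br_eq_zero hyc hsq hysq
    rw [hcy] at hsq1
    obtain ⟨z', hz'⟩ := exists_rel_of_squareCentral hxAS hxby hsq1 h1 hxb
      (by rw [br_comm, hbb]) hb ha
    exact ⟨_, z', hz'⟩

include h16 in
/-- Any two quadruples are connected by three changes of at most three generators. -/
theorem chain_lambdaThree : ChainOf (Step (F := F) LambdaThree) 3 p.cls q.cls := by
  have rp := p.rel
  have rq := q.rel
  obtain ⟨v, hv⟩ : ∃ v, v = br p.x q.x := ⟨_, rfl⟩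
  by_cases hv0 : v = 0
  · have hpq : br p.x q.x = 0 := by rw [← hv, hv0]
    rcases rp.exists_rel_of_commute_artinSchreier h16 hpq q.x_artinSchreier (a := q.y)
      (by rw [rq.xy]; exact rq.y_ne) with ⟨y', u', r⟩ | ⟨c, hc⟩
    · refine .left (Q := (r.quad h16).cls) (.intro (.inl rfl)) ?_
      rw [← Quad.cls_swap]
      exact .left (Q := q.cls) (.intro (.inl rfl)) (.refl _ _ _)
    · have hqx : q.x = algebraMap F A c + p.x := by rw [← hc, add_assoc, add_self_zero, add_zero]
      have key : ∀ a, br q.x a = br p.x a := fun a => by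
        rw [hqx, br_add_left, br_comm _ a, br_algebraMap, zero_add]
      have r : Rel q.x p.y p.z p.u := ⟨by rw [key, rp.xy], rp.zu, by rw [key, rp.xz],
        by rw [key, rp.xu], rp.yz, rp.yu, rp.y_ne, rp.u_ne⟩
      exact .left (Q := (r.quad h16).cls) (.intro (.inr (.inl rfl)))
        (.left (Q := q.cls) (.intro (.inl rfl)) (.refl _ _ _))
  have h1 : br p.x v = v := by rw [hv, br_br_of_artinSchreier p.x_artinSchreier]
  have h2 : br q.x v = v := by
    rw [hv, br_comm p.x, br_br_of_artinSchreier q.x_artinSchreier]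
  by_cases hsq : ∃ n : F, v ^ 2 = algebraMap F A n
  · obtain ⟨_, _, r1⟩ := rp.exists_rel h16 h1 hsq hv0
    obtain ⟨_, _, r2⟩ := rq.exists_rel h16 h2 hsq hv0
    exact .left (Q := (r1.quad h16).cls) (.intro (.inl rfl))
      (.left (Q := (r2.quad h16).cls) (.intro (.inr (.inl rfl)))
      (.left (Q := q.cls) (.intro (.inl rfl)) (.refl _ _ _)))
  have h3 := br_sq_of_flip h1
  have h4 := br_sq_of_flip h2
  obtain ⟨a, ha⟩ : ∃ a, br (v ^ 2) a ≠ 0 := by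
    by_contra! h
    exact hsq (rp.exists_algebraMap h16 (br_swap_eq_zero (h _)) (br_swap_eq_zero (h _))
      (br_swap_eq_zero (h _)) (br_swap_eq_zero (h _)))
  have hpq : br p.x q.x ≠ 0 := by rwa [← hv]
  -- Both x and x′ commute with v² but not with each other, so v² is quadratic.
  obtain ⟨t, n, hn⟩ := exists_sq_eq_of_br_ne_zero h16 h3 h4 hpq ha
  obtain ⟨b, hb, hba, hb' | hb'⟩ := exists_normalized hn ha
  · have hpb := hb _ h3
    have hqb := hb _ h4
    rcases rp.exists_rel_of_commute_artinSchreier h16 hpb hb' hba with ⟨_, _, r1⟩ | ⟨c, hc⟩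
    · rcases rq.exists_rel_of_commute_artinSchreier h16 hqb hb' hba with ⟨_, _, r2⟩ | ⟨c, hc⟩
      · exact .left (Q := (r1.quad h16).cls) (.intro (.inl rfl))
          (.left (Q := (r2.quad h16).cls) (.intro (.inr (.inr (.inl rfl))))
          (.left (Q := q.cls) (.intro (.inl rfl)) (.refl _ _ _)))
      · have := congrArg (br p.x) hc
        rw [br_add_right, hpb, br_algebraMap, zero_add] at this
        exact absurd this hpq
    · have := congrArg (br q.x) hc
      rw [br_add_right, hqb, br_algebraMap, zero_add, br_comm] at this
      exact absurd this hpq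
  · obtain ⟨_, _, r1⟩ := rp.exists_rel_of_commute_squareCentral h16 (hb _ h3) hb' hba
    obtain ⟨_, _, r2⟩ := rq.exists_rel_of_commute_squareCentral h16 (hb _ h4) hb' hba
    exact .left (Q := (r1.quad h16).cls) (.intro (.inl rfl))
      (.left (Q := (r2.quad h16).cls) (.intro (.inr (.inr (.inr rfl))))
      (.left (Q := q.cls) (.intro (.inl rfl)) (.refl _ _ _)))

end LambdaThreeSteps

/-! ### Counting steps -/

section Main

variable [DivisionRing A] [Algebra F A]

theorem IsBiquaternion.finrank_eq (hA : IsBiquaternion F A) : Module.finrank F A = 16 := by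
  obtain ⟨α, β, γ, δ, -, -, ⟨e⟩⟩ := hA
  rw [e.toLinearEquiv.finrank_eq, Module.finrank_tensorProduct, QuaternionAlgebra.finrank_eq_four,
    QuaternionAlgebra.finrank_eq_four]

variable [CharP A 2] [FiniteDimensional F A]
variable (h16 : Module.finrank F A = 16) {P Q : Sym2 (A × A)}

include h16 in
theorem chain_of_step_pairChange {S : Sym2 (A × A) → Sym2 (A × A) → Prop}
    (h : Step (F := F) PairChange P Q) : Chain (Step (F := F) LambdaOne) S 3 0 P Q := by
  obtain ⟨p, q, rfl, rfl, h | h⟩ := h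
  · rw [← p.cls_swap, ← q.cls_swap]
    exact chain_of_pairChange h16 _ _ h.1 h.2
  · exact chain_of_pairChange h16 _ _ h.1 h.2

theorem OmegaS.omega {p q : Quad F A} (h : OmegaS p q) : Omega p q := .inr (.inl h)
theorem OmegaI.omega {p q : Quad F A} (h : OmegaI p q) : Omega p q := .inl h
theorem OmegaC.omega {p q : Quad F A} (h : OmegaC p q) : Omega p q := .inr (.inr h)

/-- Weakening of a chain to all types of `Omega`-steps. -/
theorem Chain.omega {R : Quad F A → Quad F A → Prop} {m n m' : ℕ}
    (h : Chain (Step (F := F) LambdaOne) (Step (F := F) R) m n P Q)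
    (hR : ∀ p q : Quad F A, R p q → Omega p q) (hm : m ≤ m') :
    Chain (Step (F := F) LambdaOne) (Step (F := F) Omega) m' n P Q :=
  h.mono (fun _ _ => Step.mono hR) hm le_rfl

include h16 in
theorem chain_of_step_lambdaTwo (h : Step (F := F) LambdaTwo P Q) :
    Chain (Step (F := F) LambdaOne) (Step (F := F) Omega) 7 1 P Q := by
  obtain ⟨p, q, rfl, rfl, h | h, h' | h'⟩ := h
  · exact (chain_of_artinSchreier_eq h16 p q h h').omega (fun _ _ => OmegaS.omega) (by norm_num)
  · rw [← p.cls_swap, ← q.cls_swap]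
    exact (chain_of_mixed_eq h16 p.swap q.swap h' h).omega (fun _ _ => OmegaC.omega) le_rfl
  · exact (chain_of_mixed_eq h16 p q h h').omega (fun _ _ => OmegaC.omega) le_rfl
  · exact (chain_of_squareCentral_eq h16 p q h h').omega (fun _ _ => OmegaI.omega) (by norm_num)

/-- A step of type `LambdaThree` may be assumed to preserve a generator of the first pair. -/
theorem exists_of_step_lambdaThree (h : Step (F := F) LambdaThree P Q) :
    ∃ p q : Quad F A, p.cls = P ∧ q.cls = Q ∧ (q.x = p.x ∨ q.y = p.y) := by
  obtain ⟨p, q, hp, hq, h | h | h | h⟩ := h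
  · exact ⟨p, q, hp, hq, .inl h⟩
  · exact ⟨p, q, hp, hq, .inr h⟩
  · exact ⟨p.swap, q.swap, p.cls_swap.trans hp, q.cls_swap.trans hq, .inl h⟩
  · exact ⟨p.swap, q.swap, p.cls_swap.trans hp, q.cls_swap.trans hq, .inr h⟩

include h16 in
theorem chain_of_step_lambdaThree (h : Step (F := F) LambdaThree P Q) :
    Chain (Step (F := F) PairChange) (Step (F := F) LambdaTwo) 3 2 P Q := by
  obtain ⟨p, q, rfl, rfl, h | h⟩ := exists_of_step_lambdaThree h
  · obtain ⟨p₁, p₂, h1, h2, h3, h4, h5, h6⟩ := exists_lambdaTwo_of_x_eq h16 p q h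
    exact .right (Q := p₁.cls) (.intro ⟨.inl h1, .inl h2⟩) (.right (Q := p₂.cls)
      (.intro ⟨.inl h3, .inr h4⟩) (.left (Q := q.cls) (.intro (.inl ⟨h5, h6⟩)) (.refl _ _ _)))
  · obtain ⟨p₁, p₂, h1, h2, h3, h4, h5, h6⟩ := exists_lambdaTwo_of_y_eq h16 p q h
    exact .right (Q := p₁.cls) (.intro ⟨.inr h1, .inl h2⟩) (.right (Q := p₂.cls)
      (.intro ⟨.inr h3, .inr h4⟩) (.left (Q := q.cls) (.intro (.inl ⟨h5, h6⟩)) (.refl _ _ _)))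

-- Only one of the two Λ₂-steps is of mixed kind, so 2 + 7 + 3 = 12 Λ₁-steps suffice.
include h16 in
theorem chain_omega_of_step_lambdaThree (h : Step (F := F) LambdaThree P Q) :
    Chain (Step (F := F) LambdaOne) (Step (F := F) Omega) 12 2 P Q := by
  obtain ⟨p, q, rfl, rfl, h | h⟩ := exists_of_step_lambdaThree h
  · obtain ⟨p₁, p₂, h1, h2, h3, h4, h5, h6⟩ := exists_lambdaTwo_of_x_eq h16 p q h
    have c1 := (chain_of_artinSchreier_eq h16 p p₁ h1 h2).omega (fun _ _ => OmegaS.omega) le_rfl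
    have c2 := (chain_of_mixed_eq h16 p₁.swap p₂.swap h4 h3).omega (fun _ _ => OmegaC.omega) le_rfl
    rw [Quad.cls_swap, Quad.cls_swap] at c2
    exact (c1.trans c2).trans (chain_of_step_pairChange h16 (.intro (.inl ⟨h5, h6⟩)))
  · obtain ⟨p₁, p₂, h1, h2, h3, h4, h5, h6⟩ := exists_lambdaTwo_of_y_eq h16 p q h
    have c1 := (chain_of_mixed_eq h16 p p₁ h1 h2).omega (fun _ _ => OmegaC.omega) le_rfl
    have c2 := (chain_of_squareCentral_eq h16 p₁ p₂ h3 h4).omega (fun _ _ => OmegaI.omega) le_rfl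
    exact (c1.trans c2).trans (chain_of_step_pairChange h16 (.intro (.inl ⟨h5, h6⟩)))

end Main

end BiquatChain

open BiquatChain in
theorem mainTheorem3 {F A : Type*} [Field F] [CharP F 2] [DivisionRing A] [Algebra F A]
    (hA : IsBiquaternion F A) :
    -- any two quadruples are connected by at most three steps of type Λ₃
    (∀ p q : Quad F A, ChainOf (Step (F := F) LambdaThree) 3 p.cls q.cls) ∧
    -- a step of type Λ₃ is achieved by at most three steps of type Π and two of type Λ₂
    (∀ P Q : Sym2 (A × A), Step (F := F) LambdaThree P Q →
      Chain (Step (F := F) PairChange) (Step (F := F) LambdaTwo) 3 2 P Q) ∧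
    -- a step of type Π is achieved by at most three steps of type Λ₁
    (∀ P Q : Sym2 (A × A), Step (F := F) PairChange P Q →
      ChainOf (Step (F := F) LambdaOne) 3 P Q) ∧
    -- a step of type Λ₂ is achieved by steps of type Λ₁ and at most one of type Ω
    (∀ P Q : Sym2 (A × A), Step (F := F) LambdaTwo P Q →
      Chain (Step (F := F) LambdaOne) (Step (F := F) Omega) 7 1 P Q) ∧
    -- more precisely: if the two square-central generators are preserved
    (∀ p q : Quad F A, q.y = p.y → q.u = p.u →
      Chain (Step (F := F) LambdaOne) (Step (F := F) OmegaI) 2 1 p.cls q.cls) ∧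
    -- if the two Artin-Schreier generators are preserved
    (∀ p q : Quad F A, q.x = p.x → q.z = p.z →
      Chain (Step (F := F) LambdaOne) (Step (F := F) OmegaS) 2 1 p.cls q.cls) ∧
    -- if one generator of each kind is preserved
    (∀ p q : Quad F A, q.y = p.y → q.z = p.z →
      (p.x * q.u + q.u * p.x ≠ q.u →
        Chain (Step (F := F) LambdaOne) (Step (F := F) OmegaC) 2 1 p.cls q.cls) ∧
      Chain (Step (F := F) LambdaOne) (Step (F := F) OmegaC) 7 1 p.cls q.cls) ∧
    -- any two quadruples are connected by at most 45 steps of types Λ₁ and Ω, at most 6 of type Ω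
    (∀ p q : Quad F A, ∃ m n : ℕ, n ≤ 6 ∧ m + n ≤ 45 ∧
      Chain (Step (F := F) LambdaOne) (Step (F := F) Omega) m n p.cls q.cls) := by
  have h16 := hA.finrank_eq
  have : CharP A 2 := charP_of_injective_algebraMap (algebraMap F A).injective 2
  have : FiniteDimensional F A := Module.finite_of_finrank_eq_succ h16
  exact ⟨chain_lambdaThree h16, fun _ _ => chain_of_step_lambdaThree h16,
    fun _ _ => chain_of_step_pairChange h16, fun _ _ => chain_of_step_lambdaTwo h16,
    chain_of_squareCentral_eq h16, chain_of_artinSchreier_eq h16,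
    fun p q hy hz => ⟨chain_of_mixed_eq_of_ne h16 p q hy hz, chain_of_mixed_eq h16 p q hy hz⟩,
    -- Three Λ₃-steps at 12 Λ₁-steps and 2 Ω-steps each: 42 in all, within the stated 45.
    fun p q => ⟨36, 6, by norm_num, by norm_num,
      (chain_lambdaThree h16 p q).bind fun _ _ => chain_omega_of_step_lambdaThree h16⟩⟩
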